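/- **Model.** Let $0<\gamma<1$ be such that $n\gamma$ is an integer for some $n\ge 1$; below $n\ge1$ always ranges over the (admissible) integers for which $n_1=n\gamma$ and $n_2=n(1-\gamma)$ are integers. The network of size $n$ has a big node $b$ and small nodes $(m,i)$, $m\in\{1,2\}$, $1\le i\le n_m$; group $m$ is $\mathcal G_m$. On one probability space there are mutually independent random variables, for all small nodes of the infinite index set: edge indicators $I_{j,i}\in\{0,1\}$ with $P(I_{j,i}=1)=p_{st}$ for $j\in\mathcal G_s$, $i\in\mathcal G_t$, where $p_{11}=p_1$, $p_{22}=p_2$, $p_{12}=p_{c_1}$, $p_{21}=p_{c_2}$; $\eta^{sb}_j\in[0,1]$; bounded $\eta^{bs}_j$; and $G^m_i$ (with values in a topological space that may depend on $m$), where within each group the $\eta^{sb}$, the $\eta^{bs}$ and the $G$ are each identically distributed. Put $p^{sb}_m=E[\eta^{sb}_j]$, $j\in\mathcal G_m$, and $W_{j,b}=\eta_j^{sb}$, $W_{j,i}=I_{j,i}(1-\eta_j^{sb})/\sum_{i'\in\mathcal G_1\cup\mathcal G_2}I_{j,i'}$ (the sum being over the nodes of the network of size $n$). Given functions $f^1,f^2,f^b$,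 the system of size $n$ is $$X^m_i=f^m(G^m_i,\bar X^m_i,\eta^{bs}_iX^b),\quad X^b=f^b(\bar X^b),\quad \bar X^m_i=\sum_{j\in\mathcal G_1\cup\mathcal G_2}X_jW_{j,i},\quad \bar X^b=\frac1n\sum_{j\in\mathcal G_1\cup\mathcal G_2}X_jW_{j,b}.$$ With $\xi^m_i(x,x_b)=f^m(G^m_i,x,\eta^{bs}_ix_b)$, the aggregate map of size $n$, on $(\bar x_b,\bar{\mathbf x})\in\mathbb R\times\mathbb R^{\mathbb N}\times\mathbb R^{\mathbb N}$, is, with $x_b=f^b(\bar x_b)$, $$\bar f^{n,m}_i=\sum_{j\in\mathcal G_1\cup\mathcal G_2}\xi_j(\bar x_j,x_b)W_{j,i}\ (i\le n_m),\quad \bar f^{n,m}_i=0\ (i>n_m),\quad \bar f^n_b=\frac1n\sum_{j\in\mathcal G_1\cup\mathcal G_2}\xi_j(\bar x_j,x_b)W_{j,b},$$ and the limit map $\bar{\mathbf f}^\infty$ is its componentwise $\limsup_n$ (on each sample path). Let $\gamma_1=\gamma$, $\gamma_2=1-\gamma$, $\gamma_{p_1}=\gamma p_1+(1-\gamma)p_{c_1}$,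 $\gamma_{p_2}=\gamma p_{c_2}+(1-\gamma)p_2$. The three-dimensional deterministic system, in $(\bar x_b,\bar x^1,\bar x^2)$, is, with $x_b=f^b(\bar x_b)$, $$\bar x^m=\sum_{s=1}^2E[\xi^s_i(\bar x^s,x_b)]\frac{\gamma_sp_{sm}}{\gamma_{p_s}}(1-p^{sb}_s)\ (m=1,2),\qquad \bar x_b=\sum_{s=1}^2\gamma_sE[\xi^s_i(\bar x^s,x_b)]\,p^{sb}_s .$$ **Assumptions.** (B.1) $f^1,f^2,f^b$ are continuous with values in $[0,y]$, $y<\infty$. (B.2) $\gamma_{p_1},\gamma_{p_2}>0$ and almost surely $\sum_{j\in\mathcal G_m}\bigl|1/\sum_{i\in\mathcal G_1\cup\mathcal G_2}I_{j,i}-1/(n\gamma_{p_m})\bigr|\to0$ as $n\to\infty$, $m=1,2$. (B.3) There are $\sigma\le1$ and $0<\varsigma\le1$ such that, for each $(m,i)$, almost surely $|\xi^m_i(x,x_b)-\xi^m_i(u,u_b)|\le\sigma(|x-u|+\varsigma|x_b-u_b|)$ for all real $x,u,x_b,u_b$; and $|f^b(x)-f^b(u)|\le|x-u|$ for all real $x,u$.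 (B.4) $\max_{m}\sum_s\gamma_sp_{sm}(1-p^{sb}_s)/\gamma_{p_s}+\sum_s\gamma_sp^{sb}_s\le1$. Finally, $\eta^{sb}_j\ge\underline\eta\ge0$ almost surely for all $j$, with $\sigma(1-\underline\eta+\varsigma\underline\eta)<1$. **Conclusion.** The three-dimensional system has a unique fixed point $(\bar x_b^\infty,\bar x^{1\infty},\bar x^{2\infty})$; it lies in $[0,y]^3$. Almost surely: the corresponding constant sequence ($\bar x^m_i=\bar x^{m\infty}$ for all $i$) is the unique fixed point of $\bar{\mathbf f}^\infty$ with all components in $[0,y]$; for each $n$ the original system and the aggregate map of size $n$ have unique fixed points; and along the full sequence $n\to\infty$ these satisfy $$\bar X^m_i(n)\to\bar x^{m\infty},\quad \bar X^b(n)\to\bar x_b^\infty,\quad X^b(n)\to f^b(\bar x_b^\infty),\quad X^m_i(n)\to f^m\bigl(G^m_i,\bar x^{m\infty},\eta^{bs}_if^b(\bar x^\infty_b)\bigr)\quad\text{for all } m,i.$$ -/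

import Mathlib

open MeasureTheory ProbabilityTheory Filter Topology

namespace FPNet

/-- A small node `(m, i)`: the `i`-th member of group `m`.  The two groups are `m = 0` and `m = 1`
(written `𝒢₁`, `𝒢₂` in words), and members are numbered from `0`. -/
abbrev Node : Type := Fin 2 × ℕ

/-- A vector with one component for the big node and one for each small node. -/
abbrev State : Type := ℝ × (Node → ℝ)

/-- The data of the random network and of its fixed-point equations. -/
structure Network (Ω : Type*) (𝓖 : Fin 2 → Type*) where
  /-- fraction of small nodes that belong to the first group -/
  γ : ℝ
  /-- probability of an edge inside group `m` -/
  p : Fin 2 → ℝ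
  /-- probability of an edge from group `m` to the other group -/
  pc : Fin 2 → ℝ
  /-- `edge j i` is the indicator of the directed edge from `j` to `i` -/
  edge : Node → Node → Ω → ℝ
  /-- fraction of weight dedicated by a small node to the big node -/
  ηsb : Node → Ω → ℝ
  /-- weight from the big node to a small node -/
  ηbs : Node → Ω → ℝ
  /-- the idiosyncratic inputs -/
  G : (m : Fin 2) → ℕ → Ω → 𝓖 m
  /-- the performance functions of the two groups -/
  f : (m : Fin 2) → 𝓖 m → ℝ → ℝ → ℝ
  /-- the performance function of the big node -/
  fb : ℝ → ℝ

/-- The basic random sources of the model. -/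
inductive Source : Type
  | edge (j i : Node)
  | toBig (j : Node)
  | fromBig (j : Node)
  | input (j : Node)

namespace Network

variable {Ω : Type*} {𝓖 : Fin 2 → Type*}

/-! ### Sizes -/

/-- `n` is an admissible number of small nodes: `n ≥ 1` and `nγ` is an integer
(hence so is `n(1-γ)`). -/
def Admissible (N : Network Ω 𝓖) (n : ℕ) : Prop :=
  0 < n ∧ ∃ k : ℕ, (k : ℝ) = n * N.γ

/-- The filter `n → ∞` along admissible `n`. -/
def sizes (N : Network Ω 𝓖) : Filter ℕ := atTop ⊓ 𝓟 {n | N.Admissible n}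

/-- Number of nodes of group `m` in the network of size `n`: for admissible `n` it is `nγ` for the
first group and `n(1-γ)` for the second one. -/
noncomputable def groupSize (N : Network Ω 𝓖) (n : ℕ) (m : Fin 2) : ℕ :=
  if m = 0 then ⌊(n : ℝ) * N.γ⌋₊ else n - ⌊(n : ℝ) * N.γ⌋₊

/-- The limiting proportion of group `m`: `γ` or `1 - γ`. -/
noncomputable def frac (N : Network Ω 𝓖) (m : Fin 2) : ℝ := if m = 0 then N.γ else 1 - N.γ

/-- Sum over all small nodes of the network of size `n`. -/
noncomputable def nodeSum (N : Network Ω 𝓖) (n : ℕ) (a : Node → ℝ) : ℝ :=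
  ∑ m : Fin 2, ∑ i ∈ Finset.range (N.groupSize n m), a (m, i)

/-! ### Graph and weights -/

/-- Probability of an edge from a node of group `s` to a node of group `t`. -/
noncomputable def edgeProb (N : Network Ω 𝓖) (s t : Fin 2) : ℝ := if s = t then N.p s else N.pc s

/-- `γ_{p_1} = γ p_1 + (1-γ) p_{c_1}` and `γ_{p_2} = γ p_{c_2} + (1-γ) p_2`. -/
noncomputable def γp (N : Network Ω 𝓖) (s : Fin 2) : ℝ := ∑ t : Fin 2, N.frac t * N.edgeProb s t

/-- Number of edges that leave `j` in the network of size `n`. -/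
noncomputable def outDegree (N : Network Ω 𝓖) (n : ℕ) (j : Node) (ω : Ω) : ℝ :=
  N.nodeSum n fun i => N.edge j i ω

/-- Weight from the small node `j` to the small node `i` in the network of size `n`
(`0` if no edge leaves `j`). -/
noncomputable def weight (N : Network Ω 𝓖) (n : ℕ) (j i : Node) (ω : Ω) : ℝ :=
  N.edge j i ω * (1 - N.ηsb j ω) / N.outDegree n j ω

/-- Aggregate seen by the small node `i` in the network of size `n`. -/
noncomputable def aggSmall (N : Network Ω 𝓖) (n : ℕ) (ω : Ω) (x : Node → ℝ) (i : Node) : ℝ :=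
  N.nodeSum n fun j => x j * N.weight n j i ω

/-- Aggregate seen by the big node, per small node, in the network of size `n`. -/
noncomputable def aggBig (N : Network Ω 𝓖) (n : ℕ) (ω : Ω) (x : Node → ℝ) : ℝ :=
  1 / (n : ℝ) * N.nodeSum n fun j => x j * N.ηsb j ω

/-! ### Fixed-point maps -/

/-- The random function `ξ^m_i (x, x_b) = f^m (G^m_i, x, η^{bs}_i x_b)`. -/
def ξ (N : Network Ω 𝓖) (i : Node) (ω : Ω) (x xb : ℝ) : ℝ :=
  N.f i.1 (N.G i.1 i.2 ω) x (N.ηbs i ω * xb)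

/-- The map whose fixed points are the solutions `(X^b, X)` of the network equations of size `n`
on the sample path `ω`.  Components of indices outside the network are set to `0`. -/
noncomputable def perfMap (N : Network Ω 𝓖) (n : ℕ) (ω : Ω) (X : State) : State :=
  (N.fb (N.aggBig n ω X.2),
    fun i => if i.2 < N.groupSize n i.1 then N.ξ i ω (N.aggSmall n ω X.2 i) X.1 else 0)

/-- The map of size `n` for the aggregates `(x̄_b, x̄)`, on the sample path `ω`.
Components of indices outside the network are set to `0`. -/
noncomputable def aggMap (N : Network Ω 𝓖) (n : ℕ) (ω : Ω) (z : State) : State :=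
  (N.aggBig n ω (fun j => N.ξ j ω (z.2 j) (N.fb z.1)),
    fun i => if i.2 < N.groupSize n i.1 then
      N.aggSmall n ω (fun j => N.ξ j ω (z.2 j) (N.fb z.1)) i else 0)

/-- The limit map for the aggregates, on the sample path `ω`: the componentwise limit superior of
the maps of size `n`. -/
noncomputable def limitMap (N : Network Ω 𝓖) (ω : Ω) (z : State) : State :=
  (limsup (fun n => (N.aggMap n ω z).1) N.sizes,
    fun i => limsup (fun n => (N.aggMap n ω z).2 i) N.sizes)

variable [MeasurableSpace Ω]

/-- `p^{sb}_m = E[η^{sb}_j]` for `j` in group `m`. -/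
noncomputable def psb (N : Network Ω 𝓖) (P : Measure Ω) (m : Fin 2) : ℝ :=
  ∫ ω, N.ηsb (m, 0) ω ∂P

/-- `E[ξ^m_i (x, x_b)]`, which does not depend on the member `i` of group `m`. -/
noncomputable def meanξ (N : Network Ω 𝓖) (P : Measure Ω) (m : Fin 2) (x xb : ℝ) : ℝ :=
  ∫ ω, N.ξ (m, 0) ω x xb ∂P

/-- The deterministic three-dimensional map, in the variables `(x̄_b, (x̄^1, x̄^2))`. -/
noncomputable def threeDimMap (N : Network Ω 𝓖) (P : Measure Ω) (z : ℝ × (Fin 2 → ℝ)) :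
    ℝ × (Fin 2 → ℝ) :=
  (∑ s : Fin 2, N.frac s * N.meanξ P s (z.2 s) (N.fb z.1) * N.psb P s,
    fun m => ∑ s : Fin 2, N.meanξ P s (z.2 s) (N.fb z.1) *
      (N.frac s * N.edgeProb s m / N.γp s) * (1 - N.psb P s))

/-- The total mean weight received in the limit by a node of group `m` from the small nodes. -/
noncomputable def received (N : Network Ω 𝓖) (P : Measure Ω) (m : Fin 2) : ℝ :=
  ∑ s : Fin 2, N.frac s * N.edgeProb s m * (1 - N.psb P s) / N.γp s

/-- The constant `ϱ`. -/
noncomputable def ϱ (N : Network Ω 𝓖) (P : Measure Ω) : ℝ :=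
  max (N.received P 1) (N.received P 0) + ∑ s : Fin 2, N.frac s * N.psb P s

/-! ### The model and the assumptions -/

variable [∀ m, MeasurableSpace (𝓖 m)]

/-- The σ-algebra generated by a source. -/
abbrev sourceσ (N : Network Ω 𝓖) : Source → MeasurableSpace Ω
  | .edge j i => MeasurableSpace.comap (N.edge j i) inferInstance
  | .toBig j => MeasurableSpace.comap (N.ηsb j) inferInstance
  | .fromBig j => MeasurableSpace.comap (N.ηbs j) inferInstance
  | .input j => MeasurableSpace.comap (N.G j.1 j.2) inferInstance

/-- The standing probabilistic description of the network. -/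
structure IsModel (N : Network Ω 𝓖) (P : Measure Ω) : Prop where
  γ_pos : 0 < N.γ
  γ_lt_one : N.γ < 1
  /-- `γ` is such that sizes `n` with `nγ` an integer exist -/
  exists_admissible : ∃ n, N.Admissible n
  measurable_edge : ∀ j i, Measurable (N.edge j i)
  measurable_ηsb : ∀ j, Measurable (N.ηsb j)
  measurable_ηbs : ∀ j, Measurable (N.ηbs j)
  measurable_G : ∀ m i, Measurable (N.G m i)
  edge_indicator : ∀ j i ω, N.edge j i ω = 0 ∨ N.edge j i ω = 1
  edge_prob : ∀ j i, P.real {ω | N.edge j i ω = 1} = N.edgeProb j.1 i.1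
  ηsb_mem : ∀ j, ∀ᵐ ω ∂P, N.ηsb j ω ∈ Set.Icc (0 : ℝ) 1
  ηbs_bounded : ∃ C : ℝ, ∀ j, ∀ᵐ ω ∂P, |N.ηbs j ω| ≤ C
  ident_ηsb : ∀ m i j, IdentDistrib (N.ηsb (m, i)) (N.ηsb (m, j)) P P
  ident_ηbs : ∀ m i j, IdentDistrib (N.ηbs (m, i)) (N.ηbs (m, j)) P P
  ident_G : ∀ m i j, IdentDistrib (N.G m i) (N.G m j) P P
  /-- all edges, weights and inputs are mutually independent -/
  indep : iIndep N.sourceσ P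

/-- Assumption on the performance functions: non-negative, continuous and bounded by `y`. -/
structure BoundedContinuous [∀ m, TopologicalSpace (𝓖 m)] (N : Network Ω 𝓖) (y : ℝ) : Prop where
  continuous_f : ∀ m, Continuous fun q : 𝓖 m × ℝ × ℝ => N.f m q.1 q.2.1 q.2.2
  continuous_fb : Continuous N.fb
  f_mem : ∀ m g x xb, N.f m g x xb ∈ Set.Icc 0 y
  fb_mem : ∀ xb, N.fb xb ∈ Set.Icc 0 y

/-- Assumption on the graph structure.  (Where an out-degree vanishes, its inverse is read as `0`;
reading it as `∞` would give a stronger assumption.) -/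
structure GraphGrowth (N : Network Ω 𝓖) (P : Measure Ω) : Prop where
  γp_pos : ∀ m, 0 < N.γp m
  growth : ∀ᵐ ω ∂P, ∀ m : Fin 2, Tendsto
    (fun n : ℕ => ∑ j ∈ Finset.range (N.groupSize n m),
      |1 / N.outDegree n (m, j) ω - 1 / (n * N.γp m)|) N.sizes (𝓝 0)

/-- Lipschitz assumption with constants `σ` and `ς`. -/
structure LipschitzBound (N : Network Ω 𝓖) (P : Measure Ω) (σ ς : ℝ) : Prop where
  σ_le_one : σ ≤ 1
  ς_pos : 0 < ς
  ς_le_one : ς ≤ 1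
  lipschitz_ξ : ∀ i, ∀ᵐ ω ∂P, ∀ x xb u ub : ℝ,
    |N.ξ i ω x xb - N.ξ i ω u ub| ≤ σ * (|x - u| + ς * |xb - ub|)
  lipschitz_fb : ∀ x u, |N.fb x - N.fb u| ≤ |x - u|

/-- Assumption on the mean weights. -/
def MeanWeightBound (N : Network Ω 𝓖) (P : Measure Ω) : Prop := N.ϱ P ≤ 1

end Network

/-- The state with value `z.1` at the big node and the constant value `z.2 m` on group `m`. -/
def constState (z : ℝ × (Fin 2 → ℝ)) : State := (z.1, fun i => z.2 i.1)

end FPNet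

/-!
Let `κ = σ (1 - η₀ + ς η₀) < 1`. Each small node hands on a total weight of at most one, of which at
least `η₀` goes to the big node (`sum_aggSmall_add_aggBig_le`). If the discrepancy at the big node
is counted with weight `ς` and those at the small nodes are averaged over the network, then the
aggregate map of every size is therefore a contraction with constant `κ`
(`RegularPath.weightedDist_aggMap_le`); averaging by group makes the three-dimensional map a
contraction with the same constant (`weightedDist_threeDimMap_le`). This gives all fixed points and
their uniqueness, except for the limit map. The network map and the aggregate map are the two
compositions of the same pair of maps, so their fixed points correspond to each other
(`existsUnique_perfMap`, `aggMap_aggregate`).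

Let `z` be the fixed point of the three-dimensional map. By Hoeffding's inequality and a union bound
over the receiving nodes, the law of large numbers holds uniformly over the network
(`ae_eventually_forall_abs_sum_le`). Replacing the out-degrees by their asymptotic equivalents costs
an error that is also uniform, so almost surely the aggregate maps of size `n`, applied to the
constant state `z`, are uniformly close to `z` (`ae_convergentPath`). Since they are contractions
with a common constant, their fixed points are close to `z` in the averaged distance
(`ConvergentPath.tendsto_weightedDist`). The weights that enter one aggregate are nearly bounded by
a multiple of `1 / n`, so closeness on average implies closeness at each node
(`ConvergentPath.tendsto_fixed`).

The limit map is not controlled by averages, as its argument may be any bounded sequence, chosen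
depending on the sample path. Here the bound on the mean weights replaces the first argument: with
`r` and `q` the total limiting weights received by a small and by the big node, `r + q ≤ 1` and
`q ≥ η₀`, whence the supremum of the discrepancies at small nodes plus `ς` times that at the big
node contracts by `σ (r + ς q) ≤ κ` towards `z`
(`ConvergentPath.eq_constState_of_limitMap_eq`).
-/

namespace FPNet

/-! ### A uniform law of large numbers -/

/-- σ-algebras generated by disjoint blocks of an independent family are independent. -/
theorem iIndep_iSup_of_pairwise_disjoint {Ω ι κ : Type*} {m : ι → MeasurableSpace Ω}
    {mΩ : MeasurableSpace Ω} {μ : Measure Ω} (hle : ∀ i, m i ≤ mΩ) (h : iIndep m μ)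
    {S : κ → Set ι} (hS : Pairwise fun j k => Disjoint (S j) (S k)) :
    iIndep (fun j => ⨆ i ∈ S j, m i) μ := by
  classical
  have := h.isProbabilityMeasure
  rw [iIndep_iff]
  intro s
  induction s using Finset.induction_on with
  | empty => simp
  | insert j s hj ih =>
    intro A hA
    have hd : Disjoint (S j) (⋃ k ∈ s, S k) := by
      simp only [Set.disjoint_iUnion_right]
      exact fun k hk => hS fun e => hj (e ▸ hk)
    have hmeas : MeasurableSet[⨆ i ∈ ⋃ k ∈ s, S k, m i] (⋂ k ∈ s, A k) := by
      refine Finset.measurableSet_biInter s fun k hk => ?_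
      refine (?_ : (⨆ i ∈ S k, m i) ≤ ⨆ i ∈ ⋃ k ∈ s, S k, m i) _
        (hA k (Finset.mem_insert_of_mem hk))
      exact biSup_mono fun i hi => Set.mem_biUnion hk hi
    rw [Finset.set_biInter_insert, Finset.prod_insert hj,
      ← ih fun k hk => hA k (Finset.mem_insert_of_mem hk)]
    exact (Indep_iff _ _ _).1 (indep_iSup_of_disjoint hle h hd) _ _
      (hA j (Finset.mem_insert_self j s)) hmeas

/-- Hoeffding's inequality for the absolute value of a centred sum, with a deviation `ε n` and at
most `n` summands. -/
theorem measureReal_abs_sum_ge_le {Ω : Type*} [MeasurableSpace Ω] {P : Measure Ω}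
    [IsProbabilityMeasure P] {Y : ℕ → Ω → ℝ} {μ C : ℝ} (hC : 0 < C) (hind : iIndepFun Y P)
    (hm : ∀ j, Measurable (Y j)) (hb : ∀ j, ∀ᵐ ω ∂P, Y j ω ∈ Set.Icc 0 C)
    (hμ : ∀ j, ∫ ω, Y j ω ∂P = μ) {k n : ℕ} (hk : k ≤ n) {ε : ℝ} (hε : 0 < ε) :
    P.real {ω | ε * n ≤ |∑ j ∈ Finset.range k, (Y j ω - μ)|} ≤
      2 * Real.exp (-(2 * ε ^ 2 / C ^ 2) * n) := by
  rcases Nat.eq_zero_or_pos n with rfl | hn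
  · simp
  have hn' : (0 : ℝ) < n := by exact_mod_cast hn
  have hkn : (k : ℝ) ≤ n := by exact_mod_cast hk
  rcases Nat.eq_zero_or_pos k with rfl | hk0
  · have : {ω : Ω | ε * n ≤ |∑ j ∈ Finset.range 0, (Y j ω - μ)|} = ∅ := by
      ext ω
      simpa using by positivity
    rw [this]
    simpa using (Real.exp_pos _).le
  have hk' : (0 : ℝ) < k := by exact_mod_cast hk0
  set c : NNReal := (‖C - 0‖₊ / 2) ^ 2 with hc
  have hcv : (c : ℝ) = C ^ 2 / 4 := by
    simp [hc, abs_of_pos hC]; ring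
  have hsub : ∀ j, HasSubgaussianMGF (fun ω => Y j ω - μ) c P := fun j => 
    hμ j ▸ hasSubgaussianMGF_of_mem_Icc (hm j).aemeasurable (hb j)
  have hi1 : iIndepFun (fun j ω => Y j ω - μ) P :=
    hind.comp (fun _ x => x - μ) fun _ => measurable_id.sub_const μ
  have hi2 : iIndepFun (fun j ω => -(Y j ω - μ)) P :=
    hind.comp (fun _ x => -(x - μ)) fun _ => (measurable_id.sub_const μ).neg
  have hεn : 0 ≤ ε * n := by positivity
  have e1 := HasSubgaussianMGF.measure_sum_range_ge_le_of_iIndepFun hi1 (n := k)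
    (fun j _ => hsub j) hεn
  have e2 := HasSubgaussianMGF.measure_sum_range_ge_le_of_iIndepFun hi2 (n := k)
    (fun j _ => (hsub j).neg) hεn
  have hexp : Real.exp (-(ε * n) ^ 2 / (2 * k * c)) ≤ Real.exp (-(2 * ε ^ 2 / C ^ 2) * n) := by
    refine Real.exp_le_exp.2 ?_
    rw [hcv, neg_div, neg_mul, neg_le_neg_iff, div_mul_eq_mul_div,
      div_le_div_iff₀ (by positivity) (by positivity)]
    have : 0 ≤ ε ^ 2 * n * C ^ 2 := by positivity
    nlinarith [mul_le_mul_of_nonneg_left hkn this]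
  calc P.real {ω | ε * n ≤ |∑ j ∈ Finset.range k, (Y j ω - μ)|}
      ≤ P.real ({ω | ε * n ≤ ∑ j ∈ Finset.range k, (Y j ω - μ)} ∪
          {ω | ε * n ≤ ∑ j ∈ Finset.range k, -(Y j ω - μ)}) := by
        refine measureReal_mono fun ω hω => ?_
        rcases le_abs.1 (show ε * n ≤ |_| from hω) with h | h
        · exact Or.inl h
        · exact Or.inr (h.trans_eq (Finset.sum_neg_distrib _).symm)
    _ ≤ _ := measureReal_union_le _ _
    _ ≤ 2 * Real.exp (-(2 * ε ^ 2 / C ^ 2) * n) := by linarith [e1.trans hexp, e2.trans hexp]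

/-- A law of large numbers that is uniform over `n` averages of at most `n` terms each: the
exponential decay in Hoeffding's inequality survives a union bound over the averages. -/
theorem ae_eventually_forall_abs_sum_le {Ω : Type*} [MeasurableSpace Ω] {P : Measure Ω}
    [IsProbabilityMeasure P] {Y : ℕ → ℕ → Ω → ℝ} {μ C : ℝ} (hC : 0 < C)
    (hind : ∀ i, iIndepFun (Y i) P) (hm : ∀ i j, Measurable (Y i j))
    (hb : ∀ i j, ∀ᵐ ω ∂P, Y i j ω ∈ Set.Icc 0 C) (hμ : ∀ i j, ∫ ω, Y i j ω ∂P = μ)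
    {k : ℕ → ℕ} (hk : ∀ n, k n ≤ n) :
    ∀ᵐ ω ∂P, ∀ ε > 0, ∀ᶠ n : ℕ in atTop, ∀ i < n,
      |∑ j ∈ Finset.range (k n), Y i j ω - k n * μ| ≤ ε * n := by
  have key : ∀ q : ℕ, ∀ᵐ ω ∂P, ∀ᶠ n : ℕ in atTop, ∀ i < n,
      |∑ j ∈ Finset.range (k n), (Y i j ω - μ)| < 1 / ((q : ℝ) + 1) * n := by
    intro q
    set ε : ℝ := 1 / ((q : ℝ) + 1)
    have hε : 0 < ε := by positivity
    set B : ℕ → Set Ω := fun n => ⋃ i ∈ Finset.range n,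
      {ω | ε * n ≤ |∑ j ∈ Finset.range (k n), (Y i j ω - μ)|}
    have hB : ∀ n, P.real (B n) ≤ 2 * (n ^ 1 * Real.exp (-(2 * ε ^ 2 / C ^ 2) * n)) := by
      intro n
      refine (measureReal_biUnion_finset_le _ _).trans ?_
      refine (Finset.sum_le_sum fun i _ =>
        measureReal_abs_sum_ge_le hC (hind i) (hm i) (hb i) (hμ i) (hk n) hε).trans_eq ?_
      simp only [Finset.sum_const, Finset.card_range, nsmul_eq_mul]
      ring
    have hs : Summable fun n => P.real (B n) :=
      Summable.of_nonneg_of_le (fun _ => measureReal_nonneg) hB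
        ((Real.summable_pow_mul_exp_neg_nat_mul 1 (by positivity)).mul_left 2)
    have hs' : (∑' n, P (B n)) ≠ ⊤ := by
      have := hs.tsum_ofReal_ne_top
      rwa [tsum_congr fun n => ofReal_measureReal (μ := P) (s := B n) (measure_ne_top _ _)] at this
    filter_upwards [ae_eventually_notMem hs'] with ω hω
    filter_upwards [hω] with n hn i hi
    by_contra hcon
    exact hn (Set.mem_biUnion (Finset.mem_coe.2 (Finset.mem_range.2 hi)) (not_lt.1 hcon))
  filter_upwards [ae_all_iff.2 key] with ω hω ε hε
  obtain ⟨q, hq⟩ := exists_nat_one_div_lt hε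
  filter_upwards [hω q] with n hn i hi
  have h1 := (hn i hi).le
  rw [Finset.sum_sub_distrib, Finset.sum_const, Finset.card_range, nsmul_eq_mul] at h1
  exact h1.trans (mul_le_mul_of_nonneg_right hq.le n.cast_nonneg)

/-! ### Independence and means in the network -/

namespace Network

variable {Ω : Type*} {𝓖 : Fin 2 → Type*} [∀ m, MeasurableSpace (𝓖 m)] {N : Network Ω 𝓖}

/-- The σ-algebra generated by a set of sources. -/
abbrev sourcesσ (N : Network Ω 𝓖) (T : Set Source) : MeasurableSpace Ω := ⨆ t ∈ T, N.sourceσ t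

theorem measurable_edge_sourcesσ {T : Set Source} {j i : Node} (h : Source.edge j i ∈ T) :
    Measurable[N.sourcesσ T] (N.edge j i) :=
  measurable_iff_comap_le.2 (le_biSup (f := fun t => N.sourceσ t) h)

theorem measurable_ηsb_sourcesσ {T : Set Source} {j : Node} (h : Source.toBig j ∈ T) :
    Measurable[N.sourcesσ T] (N.ηsb j) :=
  measurable_iff_comap_le.2 (le_biSup (f := fun t => N.sourceσ t) h)

/-- A function of the idiosyncratic input and of the weight from the big node, at each small
node. -/
def nodeFun (N : Network Ω 𝓖) (F : (s : Fin 2) → 𝓖 s → ℝ → ℝ) (j : Node) (ω : Ω) : ℝ :=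
  F j.1 (N.G j.1 j.2 ω) (N.ηbs j ω)

variable {F : (s : Fin 2) → 𝓖 s → ℝ → ℝ}

theorem measurable_nodeFun_sourcesσ (hF : ∀ s, Measurable (Function.uncurry (F s)))
    {T : Set Source} {j : Node} (h : Source.fromBig j ∈ T) (h' : Source.input j ∈ T) :
    Measurable[N.sourcesσ T] (N.nodeFun F j) := by
  have h1 : Measurable[N.sourcesσ T] (N.ηbs j) :=
    measurable_iff_comap_le.2 (le_biSup (f := fun t => N.sourceσ t) h)
  have h2 : Measurable[N.sourcesσ T] (N.G j.1 j.2) :=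
    measurable_iff_comap_le.2 (le_biSup (f := fun t => N.sourceσ t) h')
  exact (hF j.1).comp (h2.prodMk h1)

variable [MeasurableSpace Ω] {P : Measure Ω}

theorem IsModel.sourceσ_le (hN : N.IsModel P) (t : Source) :
    N.sourceσ t ≤ ‹MeasurableSpace Ω› := by
  cases t with
  | edge j i => exact (hN.measurable_edge j i).comap_le
  | toBig j => exact (hN.measurable_ηsb j).comap_le
  | fromBig j => exact (hN.measurable_ηbs j).comap_le
  | input j => exact (hN.measurable_G j.1 j.2).comap_le

/-- Random variables that depend on disjoint sets of sources are independent. -/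
theorem IsModel.indepFun (hN : N.IsModel P) {T U : Set Source} (hTU : Disjoint T U)
    {β β' : Type*} [MeasurableSpace β] [MeasurableSpace β'] {f : Ω → β} {g : Ω → β'}
    (hf : Measurable[N.sourcesσ T] f) (hg : Measurable[N.sourcesσ U] g) : IndepFun f g P := by
  rw [IndepFun_iff_Indep]
  exact indep_of_indep_of_le_left (indep_of_indep_of_le_right
    (indep_iSup_of_disjoint hN.sourceσ_le hN.indep hTU) hg.comap_le) hf.comap_le

theorem IsModel.iIndepFun (hN : N.IsModel P) {κ : Type*} {T : κ → Set Source}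
    (hT : Pairwise fun j k => Disjoint (T j) (T k)) {f : κ → Ω → ℝ}
    (hf : ∀ k, Measurable[N.sourcesσ (T k)] (f k)) : iIndepFun f P := by
  rw [iIndepFun_iff_iIndep]
  exact iIndep_of_iIndep_of_le
    (iIndep_iSup_of_pairwise_disjoint hN.sourceσ_le hN.indep hT) fun k => (hf k).comap_le

theorem IsModel.measurable_nodeFun (hN : N.IsModel P)
    (hF : ∀ s, Measurable (Function.uncurry (F s))) (j : Node) : Measurable (N.nodeFun F j) :=
  (hF j.1).comp ((hN.measurable_G j.1 j.2).prodMk (hN.measurable_ηbs j))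

theorem IsModel.integral_nodeFun [IsProbabilityMeasure P] (hN : N.IsModel P)
    (hF : ∀ s, Measurable (Function.uncurry (F s))) (s : Fin 2) (k : ℕ) :
    ∫ ω, N.nodeFun F (s, k) ω ∂P = ∫ ω, N.nodeFun F (s, 0) ω ∂P := by
  have hi : ∀ k, IndepFun (N.G s k) (N.ηbs (s, k)) P := fun k =>
    hN.indepFun (T := {Source.input (s, k)}) (U := {Source.fromBig (s, k)}) (by simp)
      (measurable_iff_comap_le.2 (le_biSup (f := fun t => N.sourceσ t)
        (show Source.input (s, k) ∈ {Source.input (s, k)} from rfl)))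
      (measurable_iff_comap_le.2 (le_biSup (f := fun t => N.sourceσ t)
        (show Source.fromBig (s, k) ∈ {Source.fromBig (s, k)} from rfl)))
  exact (((hN.ident_G s k 0).prodMk (hN.ident_ηbs s k 0) (hi k) (hi 0)).comp (hF s)).integral_eq

theorem IsModel.integral_edge (hN : N.IsModel P) (j i : Node) :
    ∫ ω, N.edge j i ω ∂P = N.edgeProb j.1 i.1 := by
  have : N.edge j i = Set.indicator {ω | N.edge j i ω = 1} 1 := by
    ext ω
    rcases hN.edge_indicator j i ω with h | h <;> simp [Set.indicator, h]
  rw [this, integral_indicator_one, hN.edge_prob]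
  exact hN.measurable_edge j i (measurableSet_singleton 1)

theorem IsModel.integral_nodeFun_mul_edge [IsProbabilityMeasure P] (hN : N.IsModel P)
    (hF : ∀ s, Measurable (Function.uncurry (F s))) (s : Fin 2) (k : ℕ) (i : Node) :
    ∫ ω, N.nodeFun F (s, k) ω * (1 - N.ηsb (s, k) ω) * N.edge (s, k) i ω ∂P =
      (∫ ω, N.nodeFun F (s, 0) ω ∂P) * (1 - N.psb P s) * N.edgeProb s i.1 := by
  have m1 := hN.measurable_nodeFun hF (s, k)
  have m2 : Measurable fun ω => 1 - N.ηsb (s, k) ω := (hN.measurable_ηsb (s, k)).const_sub 1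
  have i1 : IndepFun (N.nodeFun F (s, k)) (fun ω => 1 - N.ηsb (s, k) ω) P :=
    hN.indepFun (T := {.fromBig (s, k), .input (s, k)}) (U := {.toBig (s, k)}) (by simp)
      (measurable_nodeFun_sourcesσ hF (by simp) (by simp))
      ((measurable_ηsb_sourcesσ (by simp)).const_sub 1)
  have i2 : IndepFun (fun ω => N.nodeFun F (s, k) ω * (1 - N.ηsb (s, k) ω))
      (N.edge (s, k) i) P :=
    hN.indepFun (T := {.fromBig (s, k), .input (s, k), .toBig (s, k)})
      (U := {.edge (s, k) i}) (by simp)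
      ((measurable_nodeFun_sourcesσ hF (by simp) (by simp)).mul
        ((measurable_ηsb_sourcesσ (by simp)).const_sub 1))
      (measurable_edge_sourcesσ (by simp))
  have hint : Integrable (N.ηsb (s, k)) P :=
    Integrable.of_mem_Icc 0 1 (hN.measurable_ηsb _).aemeasurable (hN.ηsb_mem _)
  rw [i2.integral_fun_mul_eq_mul_integral (m1.mul m2).aestronglyMeasurable
      (hN.measurable_edge _ _).aestronglyMeasurable,
    i1.integral_fun_mul_eq_mul_integral m1.aestronglyMeasurable m2.aestronglyMeasurable,
    hN.integral_nodeFun hF, hN.integral_edge, integral_sub (integrable_const 1) hint,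
    (hN.ident_ηsb s k 0).integral_eq]
  simp [psb]

theorem IsModel.integral_nodeFun_mul_ηsb [IsProbabilityMeasure P] (hN : N.IsModel P)
    (hF : ∀ s, Measurable (Function.uncurry (F s))) (s : Fin 2) (k : ℕ) :
    ∫ ω, N.nodeFun F (s, k) ω * N.ηsb (s, k) ω ∂P =
      (∫ ω, N.nodeFun F (s, 0) ω ∂P) * N.psb P s := by
  have i1 : IndepFun (N.nodeFun F (s, k)) (N.ηsb (s, k)) P :=
    hN.indepFun (T := {.fromBig (s, k), .input (s, k)}) (U := {.toBig (s, k)}) (by simp)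
      (measurable_nodeFun_sourcesσ hF (by simp) (by simp)) (measurable_ηsb_sourcesσ (by simp))
  rw [i1.integral_fun_mul_eq_mul_integral (hN.measurable_nodeFun hF _).aestronglyMeasurable
      (hN.measurable_ηsb _).aestronglyMeasurable, hN.integral_nodeFun hF,
    (hN.ident_ηsb s k 0).integral_eq, psb]

theorem IsModel.groupSize_le (hN : N.IsModel P) (n : ℕ) (m : Fin 2) : N.groupSize n m ≤ n := by
  unfold groupSize
  split_ifs
  · refine Nat.floor_le_of_le ?_
    nlinarith [hN.γ_lt_one, (n.cast_nonneg : (0 : ℝ) ≤ n)]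
  · exact Nat.sub_le _ _

/-- On almost every sample path, the partial sums received from group `s`, before division by the
out-degrees, are close to their means, uniformly over the first `n` receiving nodes. -/
theorem IsModel.ae_sum_nodeFun_mul_edge [IsProbabilityMeasure P] (hN : N.IsModel P)
    (hF : ∀ s, Measurable (Function.uncurry (F s))) {C : ℝ} (hC : 0 < C)
    (hb : ∀ s g e, F s g e ∈ Set.Icc 0 C) :
    ∀ᵐ ω ∂P, ∀ s m : Fin 2, ∀ ε > 0, ∀ᶠ n : ℕ in atTop, ∀ i < n,
      |∑ k ∈ Finset.range (N.groupSize n s),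
          N.nodeFun F (s, k) ω * (1 - N.ηsb (s, k) ω) * N.edge (s, k) (m, i) ω -
        N.groupSize n s *
          ((∫ ω, N.nodeFun F (s, 0) ω ∂P) * (1 - N.psb P s) * N.edgeProb s m)| ≤ ε * n := by
  refine ae_all_iff.2 fun s => ae_all_iff.2 fun m => ?_
  refine ae_eventually_forall_abs_sum_le (Y := fun i k ω =>
    N.nodeFun F (s, k) ω * (1 - N.ηsb (s, k) ω) * N.edge (s, k) (m, i) ω) hC ?_ ?_ ?_ ?_
    fun n => hN.groupSize_le n s
  · refine fun i => hN.iIndepFun (T := fun k =>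
      {.fromBig (s, k), .input (s, k), .toBig (s, k), .edge (s, k) (m, i)}) ?_ fun k => ?_
    · intro j k hjk
      simp [hjk.symm]
    · exact ((measurable_nodeFun_sourcesσ hF (by simp) (by simp)).mul
        ((measurable_ηsb_sourcesσ (by simp)).const_sub 1)).mul (measurable_edge_sourcesσ (by simp))
  · exact fun i k => ((hN.measurable_nodeFun hF _).mul
      ((hN.measurable_ηsb _).const_sub 1)).mul (hN.measurable_edge _ _)
  · intro i k
    filter_upwards [hN.ηsb_mem (s, k)] with ω hω
    have h1 : N.nodeFun F (s, k) ω ∈ Set.Icc 0 C := hb _ _ _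
    have h2 : 0 ≤ 1 - N.ηsb (s, k) ω := by linarith [hω.2]
    have h3 : N.nodeFun F (s, k) ω * (1 - N.ηsb (s, k) ω) ≤ C := by
      nlinarith [h1.1, h1.2, hω.1, mul_nonneg h1.1 hω.1]
    rcases hN.edge_indicator (s, k) (m, i) ω with h | h
    · simp [h, hC.le]
    · simpa [h] using ⟨mul_nonneg h1.1 h2, h3⟩
  · exact fun i k => hN.integral_nodeFun_mul_edge hF s k (m, i)

theorem IsModel.ae_sum_nodeFun_mul_ηsb [IsProbabilityMeasure P] (hN : N.IsModel P)
    (hF : ∀ s, Measurable (Function.uncurry (F s))) {C : ℝ} (hC : 0 < C)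
    (hb : ∀ s g e, F s g e ∈ Set.Icc 0 C) :
    ∀ᵐ ω ∂P, ∀ s : Fin 2, ∀ ε > 0, ∀ᶠ n : ℕ in atTop,
      |∑ k ∈ Finset.range (N.groupSize n s), N.nodeFun F (s, k) ω * N.ηsb (s, k) ω -
        N.groupSize n s * ((∫ ω, N.nodeFun F (s, 0) ω ∂P) * N.psb P s)| ≤ ε * n := by
  refine ae_all_iff.2 fun s => ?_
  have := ae_eventually_forall_abs_sum_le (P := P) (Y := fun _ k ω =>
    N.nodeFun F (s, k) ω * N.ηsb (s, k) ω) hC ?_ ?_ ?_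
    (fun _ k => hN.integral_nodeFun_mul_ηsb hF s k) fun n => hN.groupSize_le n s
  · filter_upwards [this] with ω hω ε hε
    filter_upwards [hω ε hε, eventually_gt_atTop 0] with n hn hn0 using hn 0 hn0
  · refine fun i => hN.iIndepFun (T := fun k =>
      {.fromBig (s, k), .input (s, k), .toBig (s, k)}) ?_ fun k => ?_
    · intro j k hjk
      simp [hjk.symm]
    · exact (measurable_nodeFun_sourcesσ hF (by simp) (by simp)).mul
        (measurable_ηsb_sourcesσ (by simp))
  · exact fun i k => (hN.measurable_nodeFun hF _).mul (hN.measurable_ηsb _)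
  · intro i k
    filter_upwards [hN.ηsb_mem (s, k)] with ω hω
    have h1 : N.nodeFun F (s, k) ω ∈ Set.Icc 0 C := hb _ _ _
    exact ⟨mul_nonneg h1.1 hω.1, by nlinarith [h1.1, h1.2, hω.1, hω.2]⟩

end Network
/-! ### Fixed points of contractions in weighted `ℓ¹` distances -/

/-- The weighted `ℓ¹` distance on `ℝ × (α → ℝ)` that sees the first component and the components
in `S`. -/
noncomputable def weightedDist {α : Type*} (S : Finset α) (c : ℝ) (w : α → ℝ)
    (x x' : ℝ × (α → ℝ)) : ℝ :=
  c * |x.1 - x'.1| + ∑ i ∈ S, w i * |x.2 i - x'.2 i|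

section weightedDist

variable {α : Type*} {S : Finset α} {c : ℝ} {w : α → ℝ}

theorem weightedDist_comm (x x' : ℝ × (α → ℝ)) :
    weightedDist S c w x x' = weightedDist S c w x' x := by
  simp only [weightedDist, abs_sub_comm]

theorem weightedDist_triangle (hc : 0 ≤ c) (hw : ∀ i ∈ S, 0 ≤ w i) (x x' x'' : ℝ × (α → ℝ)) :
    weightedDist S c w x x'' ≤ weightedDist S c w x x' + weightedDist S c w x' x'' := by
  have h1 := mul_le_mul_of_nonneg_left (abs_sub_le x.1 x'.1 x''.1) hc
  have h2 := Finset.sum_le_sum fun i hi =>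
    mul_le_mul_of_nonneg_left (abs_sub_le (x.2 i) (x'.2 i) (x''.2 i)) (hw i hi)
  simp only [mul_add, Finset.sum_add_distrib] at h1 h2
  simp only [weightedDist]
  linarith

theorem mul_abs_fst_le_weightedDist (hw : ∀ i ∈ S, 0 ≤ w i) (x x' : ℝ × (α → ℝ)) :
    c * |x.1 - x'.1| ≤ weightedDist S c w x x' :=
  le_add_of_nonneg_right (Finset.sum_nonneg fun i hi => mul_nonneg (hw i hi) (abs_nonneg _))

theorem mul_abs_snd_le_weightedDist (hc : 0 ≤ c) (hw : ∀ i ∈ S, 0 ≤ w i) (x x' : ℝ × (α → ℝ))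
    {i : α} (hi : i ∈ S) : w i * |x.2 i - x'.2 i| ≤ weightedDist S c w x x' := by
  have h := Finset.single_le_sum (f := fun i => w i * |x.2 i - x'.2 i|)
    (fun i hi => mul_nonneg (hw i hi) (abs_nonneg _)) hi
  exact h.trans (le_add_of_nonneg_left (mul_nonneg hc (abs_nonneg _)))

theorem weightedDist_nonneg (hc : 0 ≤ c) (hw : ∀ i ∈ S, 0 ≤ w i) (x x' : ℝ × (α → ℝ)) :
    0 ≤ weightedDist S c w x x' :=
  (mul_nonneg hc (abs_nonneg _)).trans (mul_abs_fst_le_weightedDist hw x x')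

theorem fst_eq_and_snd_eq_of_weightedDist_le_zero (hc : 0 < c) (hw : ∀ i ∈ S, 0 < w i)
    {x x' : ℝ × (α → ℝ)} (h : weightedDist S c w x x' ≤ 0) :
    x.1 = x'.1 ∧ ∀ i ∈ S, x.2 i = x'.2 i := by
  have hw' : ∀ i ∈ S, 0 ≤ w i := fun i hi => (hw i hi).le
  constructor
  · have h1 := (mul_abs_fst_le_weightedDist hw' x x').trans h
    have := nonpos_of_mul_nonpos_right h1 hc
    exact sub_eq_zero.1 (abs_nonpos_iff.1 this)
  · intro i hi
    have h1 := (mul_abs_snd_le_weightedDist hc.le hw' x x' hi).trans h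
    have := nonpos_of_mul_nonpos_right h1 (hw i hi)
    exact sub_eq_zero.1 (abs_nonpos_iff.1 this)

/-- Banach's fixed-point theorem for a weighted `ℓ¹` distance that sees finitely many components,
when all other components of the map vanish. -/
theorem existsUnique_fixed_of_weightedDist_le (hc : 0 < c) (hw : ∀ i ∈ S, 0 < w i) {K : ℝ}
    (hK : K < 1) {T : ℝ × (α → ℝ) → ℝ × (α → ℝ)} (hT : ∀ x, ∀ i ∉ S, (T x).2 i = 0)
    (hcon : ∀ x x', weightedDist S c w (T x) (T x') ≤ K * weightedDist S c w x x') :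
    ∃! x, T x = x := by
  have hw' : ∀ i ∈ S, 0 ≤ w i := fun i hi => (hw i hi).le
  have hnn := weightedDist_nonneg (S := S) hc.le hw'
  set K' := max K 0
  have hK' : K' < 1 := max_lt hK one_pos
  have hcon' : ∀ x x', weightedDist S c w (T x) (T x') ≤ K' * weightedDist S c w x x' :=
    fun x x' => (hcon x x').trans (mul_le_mul_of_nonneg_right (le_max_left _ _) (hnn _ _))
  have heq : ∀ {x x'}, (∀ i ∉ S, x.2 i = x'.2 i) → weightedDist S c w x x' ≤ 0 → x = x' := by
    intro x x' h1 h2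
    obtain ⟨h3, h4⟩ := fst_eq_and_snd_eq_of_weightedDist_le_zero hc hw h2
    refine Prod.ext h3 (funext fun i => ?_)
    by_cases hi : i ∈ S
    exacts [h4 i hi, h1 i hi]
  set u : ℕ → ℝ × (α → ℝ) := fun k => T^[k] (0, 0)
  have hu : ∀ k, u (k + 1) = T (u k) := fun k => Function.iterate_succ_apply' _ _ _
  set d := weightedDist S c w (u 0) (u 1)
  have hgeo : ∀ k, weightedDist S c w (u k) (u (k + 1)) ≤ d * K' ^ k := by
    intro k
    induction k with
    | zero => simp [d]
    | succ k ih =>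
      rw [hu (k + 1), hu k, ← hu k]
      calc _ ≤ K' * weightedDist S c w (u k) (u (k + 1)) := by
              rw [hu k]; exact hcon' _ _
        _ ≤ K' * (d * K' ^ k) := mul_le_mul_of_nonneg_left ih (le_max_right _ _)
        _ = d * K' ^ (k + 1) := by ring
  have hlim1 : ∃ l, Tendsto (fun k => (u k).1) atTop (𝓝 l) := by
    refine cauchySeq_tendsto_of_complete (cauchySeq_of_le_geometric K' (d / c) hK' fun k => ?_)
    rw [Real.dist_eq, div_mul_eq_mul_div, le_div_iff₀' hc]
    exact (mul_abs_fst_le_weightedDist hw' _ _).trans (hgeo k)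
  have hlim2 : ∀ i, ∃ l, Tendsto (fun k => (u k).2 i) atTop (𝓝 l) ∧ (i ∉ S → l = 0) := by
    intro i
    by_cases hi : i ∈ S
    · obtain ⟨l, hl⟩ := cauchySeq_tendsto_of_complete
        (cauchySeq_of_le_geometric (f := fun k => (u k).2 i) K' (d / w i) hK' fun k => by
          rw [Real.dist_eq, div_mul_eq_mul_div, le_div_iff₀' (hw i hi)]
          exact (mul_abs_snd_le_weightedDist hc.le hw' _ _ hi).trans (hgeo k))
      exact ⟨l, hl, fun h => absurd hi h⟩
    · refine ⟨0, ?_, fun _ => rfl⟩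
      refine tendsto_const_nhds.congr fun k => ?_
      cases k with
      | zero => rfl
      | succ k => rw [hu, hT _ i hi]
  obtain ⟨l, hl⟩ := hlim1
  choose l' hl' hl0 using hlim2
  have hD : Tendsto (fun k => weightedDist S c w (u k) (l, l')) atTop (𝓝 0) := by
    have h1 : Tendsto (fun k => c * |(u k).1 - l|) atTop (𝓝 (c * |l - l|)) :=
      ((hl.sub_const l).abs).const_mul c
    have h2 : Tendsto (fun k => ∑ i ∈ S, w i * |(u k).2 i - l' i|) atTop
        (𝓝 (∑ i ∈ S, w i * |l' i - l' i|)) :=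
      tendsto_finsetSum _ fun i _ => (((hl' i).sub_const (l' i)).abs).const_mul (w i)
    simpa [weightedDist] using h1.add h2
  have hfix : T (l, l') = (l, l') := by
    refine heq (fun i hi => (hT _ i hi).trans (hl0 i hi).symm) ?_
    have hD1 := (hD.const_mul K').add (hD.comp (tendsto_add_atTop_nat 1))
    simp only [mul_zero, add_zero] at hD1
    refine ge_of_tendsto' hD1 fun k => ?_
    refine (weightedDist_triangle hc.le hw' _ (u (k + 1)) _).trans (add_le_add ?_ le_rfl)
    rw [weightedDist_comm, hu]
    exact hcon' _ _
  refine ⟨(l, l'), hfix, fun x hx => heq (fun i hi => ?_) ?_⟩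
  · rw [← hx, hT _ i hi]
    exact (hl0 i hi).symm
  · have h := hcon' x (l, l')
    rw [hx, hfix] at h
    nlinarith [hnn x (l, l')]

end weightedDist

namespace Network

variable {Ω : Type*} {𝓖 : Fin 2 → Type*} {N : Network Ω 𝓖}

/-! ### The contraction on sample paths -/

/-- The small nodes of the network of size `n`. -/
noncomputable def nodes (N : Network Ω 𝓖) (n : ℕ) : Finset Node :=
  (Finset.univ.sigma fun m => Finset.range (N.groupSize n m)).map
    (Equiv.sigmaEquivProd (Fin 2) ℕ).toEmbedding

theorem mem_nodes {n : ℕ} {i : Node} : i ∈ N.nodes n ↔ i.2 < N.groupSize n i.1 := by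
  obtain ⟨m, i⟩ := i
  simp [nodes]

theorem nodeSum_eq_sum_nodes (n : ℕ) (a : Node → ℝ) : N.nodeSum n a = ∑ i ∈ N.nodes n, a i := by
  simp [nodes, nodeSum, Finset.sum_sigma]

theorem sum_weight_le {ω : Ω} {n : ℕ} {j : Node} (h1 : N.ηsb j ω ≤ 1) :
    ∑ i ∈ N.nodes n, N.weight n j i ω ≤ 1 - N.ηsb j ω := by
  simp only [weight, ← Finset.sum_div, ← Finset.sum_mul]
  rw [← nodeSum_eq_sum_nodes, mul_comm, mul_div_assoc]
  exact mul_le_of_le_one_right (by linarith) (div_self_le_one _)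

theorem outDegree_nonneg {ω : Ω} {n : ℕ} {j : Node} (he : ∀ i, 0 ≤ N.edge j i ω) :
    0 ≤ N.outDegree n j ω := by
  rw [outDegree, nodeSum_eq_sum_nodes]
  exact Finset.sum_nonneg fun i _ => he i

theorem weight_nonneg {ω : Ω} {n : ℕ} {j i : Node} (h1 : N.ηsb j ω ≤ 1)
    (he : ∀ i, 0 ≤ N.edge j i ω) : 0 ≤ N.weight n j i ω :=
  div_nonneg (mul_nonneg (he i) (by linarith)) (outDegree_nonneg he)

theorem abs_aggSmall_sub_le {ω : Ω} {n : ℕ} (a b : Node → ℝ) {i : Node}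
    (hw : ∀ j, 0 ≤ N.weight n j i ω) :
    |N.aggSmall n ω a i - N.aggSmall n ω b i| ≤ N.aggSmall n ω (fun j => |a j - b j|) i := by
  simp only [aggSmall, nodeSum_eq_sum_nodes, ← Finset.sum_sub_distrib, ← sub_mul]
  refine (Finset.abs_sum_le_sum_abs _ _).trans_eq (Finset.sum_congr rfl fun j _ => ?_)
  rw [abs_mul, abs_of_nonneg (hw j)]

theorem abs_aggBig_sub_le {ω : Ω} {n : ℕ} (a b : Node → ℝ) (hη : ∀ j, 0 ≤ N.ηsb j ω) :
    |N.aggBig n ω a - N.aggBig n ω b| ≤ N.aggBig n ω (fun j => |a j - b j|) := by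
  simp only [aggBig, nodeSum_eq_sum_nodes, ← mul_sub, ← Finset.sum_sub_distrib, ← sub_mul]
  rw [abs_mul, abs_of_nonneg (by positivity : (0 : ℝ) ≤ 1 / n)]
  refine mul_le_mul_of_nonneg_left ?_ (by positivity)
  refine (Finset.abs_sum_le_sum_abs _ _).trans_eq (Finset.sum_congr rfl fun j _ => ?_)
  rw [abs_mul, abs_of_nonneg (hη j)]

/-- Every small node distributes a weight of at most one, of which at least `η₀` goes to the big
node. -/
theorem sum_aggSmall_add_aggBig_le {ω : Ω} {n : ℕ} {ς η₀ : ℝ} (hς1 : ς ≤ 1)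
    (hη : ∀ j, N.ηsb j ω ∈ Set.Icc η₀ 1) {a : Node → ℝ} (ha : ∀ j, 0 ≤ a j) :
    ς * N.aggBig n ω a + ∑ i ∈ N.nodes n, 1 / (n : ℝ) * N.aggSmall n ω a i ≤
      (1 - η₀ + ς * η₀) * (1 / (n : ℝ) * ∑ j ∈ N.nodes n, a j) := by
  simp only [aggBig, aggSmall, nodeSum_eq_sum_nodes, ← Finset.mul_sum]
  rw [Finset.sum_comm]
  have h : ς * ∑ j ∈ N.nodes n, a j * N.ηsb j ω +
      ∑ j ∈ N.nodes n, ∑ i ∈ N.nodes n, a j * N.weight n j i ω ≤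
      (1 - η₀ + ς * η₀) * ∑ j ∈ N.nodes n, a j := by
    rw [Finset.mul_sum, Finset.mul_sum, ← Finset.sum_add_distrib]
    refine Finset.sum_le_sum fun j _ => ?_
    rw [← Finset.mul_sum]
    have h1 := mul_le_mul_of_nonneg_left (sum_weight_le (n := n) (hη j).2) (ha j)
    have h2 : 0 ≤ a j * ((1 - ς) * (N.ηsb j ω - η₀)) :=
      mul_nonneg (ha j) (mul_nonneg (by linarith) (by linarith [(hη j).1]))
    nlinarith
  have := mul_le_mul_of_nonneg_left h (by positivity : (0 : ℝ) ≤ 1 / n)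
  linarith

/-- The sample paths on which the almost sure properties of the weights, of the performance
functions and of the graph hold. -/
structure RegularPath (N : Network Ω 𝓖) (σ ς η₀ : ℝ) (ω : Ω) : Prop where
  edge_mem : ∀ j i, N.edge j i ω ∈ Set.Icc (0 : ℝ) 1
  ηsb_mem : ∀ j, N.ηsb j ω ∈ Set.Icc η₀ 1
  lipschitz : ∀ i x xb u ub, |N.ξ i ω x xb - N.ξ i ω u ub| ≤ σ * (|x - u| + ς * |xb - ub|)
  growth : ∀ m : Fin 2, Tendsto
    (fun n : ℕ => ∑ j ∈ Finset.range (N.groupSize n m),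
      |1 / N.outDegree n (m, j) ω - 1 / (n * N.γp m)|) N.sizes (𝓝 0)

/-- The performances of the small nodes as functions of the aggregates, for all indices, also those
outside the network. -/
noncomputable def perf (N : Network Ω 𝓖) (ω : Ω) (x : State) (j : Node) : ℝ :=
  N.ξ j ω (x.2 j) (N.fb x.1)

/-- The map of size `n` that turns performances into aggregates, with `0` for indices outside the
network. -/
noncomputable def aggregate (N : Network Ω 𝓖) (n : ℕ) (ω : Ω) (X : State) : State :=
  (N.aggBig n ω X.2, fun i => if i.2 < N.groupSize n i.1 then N.aggSmall n ω X.2 i else 0)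

theorem groupSize_of_admissible (hγ1 : N.γ < 1) {n : ℕ} (hn : N.Admissible n) (s : Fin 2) :
    (N.groupSize n s : ℝ) = n * N.frac s := by
  obtain ⟨hn0, k, hk⟩ := hn
  have hkn : k ≤ n := by
    have : (k : ℝ) ≤ n := by
      rw [hk]
      exact mul_le_of_le_one_right n.cast_nonneg hγ1.le
    exact_mod_cast this
  have hfl : ⌊(n : ℝ) * N.γ⌋₊ = k := by rw [← hk, Nat.floor_natCast]
  fin_cases s
  · simp [groupSize, frac, hfl, hk]
  · simp [groupSize, frac, hfl, Nat.cast_sub hkn, hk]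
    ring

theorem card_nodes (hγ1 : N.γ < 1) {n : ℕ} (hn : N.Admissible n) :
    ((N.nodes n).card : ℝ) = n := by
  have h0 := groupSize_of_admissible hγ1 hn 0
  have h1 := groupSize_of_admissible hγ1 hn 1
  simp only [nodes, Finset.card_map, Finset.card_sigma, Finset.card_range, Fin.sum_univ_two,
    Nat.cast_add, h0, h1, frac]
  simp
  ring

theorem RegularPath.weight_nonneg {σ ς η₀ : ℝ} {ω : Ω} (h : N.RegularPath σ ς η₀ ω) (n : ℕ)
    (j i : Node) : 0 ≤ N.weight n j i ω :=
  Network.weight_nonneg (h.ηsb_mem j).2 fun i => (h.edge_mem j i).1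

theorem RegularPath.mean_abs_perf_sub_le {σ ς η₀ : ℝ} (hγ1 : N.γ < 1) (hσ : 0 ≤ σ) (hς : 0 ≤ ς)
    (hfb : ∀ x u, |N.fb x - N.fb u| ≤ |x - u|) {ω : Ω} (h : N.RegularPath σ ς η₀ ω) {n : ℕ}
    (hn : N.Admissible n) (x x' : State) :
    1 / (n : ℝ) * ∑ j ∈ N.nodes n, |N.perf ω x j - N.perf ω x' j| ≤
      σ * weightedDist (N.nodes n) ς (fun _ => 1 / (n : ℝ)) x x' := by
  have hn0 : (0 : ℝ) < n := by exact_mod_cast hn.1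
  have h1 : ∑ j ∈ N.nodes n, |N.perf ω x j - N.perf ω x' j| ≤
      ∑ j ∈ N.nodes n, σ * (|x.2 j - x'.2 j| + ς * |x.1 - x'.1|) := by
    refine Finset.sum_le_sum fun j _ => (h.lipschitz j _ _ _ _).trans ?_
    exact mul_le_mul_of_nonneg_left
      (add_le_add le_rfl (mul_le_mul_of_nonneg_left (hfb _ _) hς)) hσ
  rw [← Finset.mul_sum, Finset.sum_add_distrib, Finset.sum_const, nsmul_eq_mul,
    card_nodes hγ1 hn] at h1
  refine (mul_le_mul_of_nonneg_left h1 (by positivity)).trans_eq ?_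
  rw [weightedDist, ← Finset.mul_sum]
  field_simp
  ring

/-- The aggregate map is a contraction for the `ℓ¹` distance that averages over the small nodes
and gives weight `ς` to the big node. -/
theorem RegularPath.weightedDist_aggMap_le {σ ς η₀ : ℝ} (hγ1 : N.γ < 1) (hσ : 0 ≤ σ)
    (hς : 0 ≤ ς) (hς1 : ς ≤ 1) (hη₀ : 0 ≤ η₀) (hη₁ : η₀ ≤ 1)
    (hfb : ∀ x u, |N.fb x - N.fb u| ≤ |x - u|) {ω : Ω} (h : N.RegularPath σ ς η₀ ω) {n : ℕ}
    (hn : N.Admissible n) (x x' : State) :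
    weightedDist (N.nodes n) ς (fun _ => 1 / (n : ℝ)) (N.aggMap n ω x) (N.aggMap n ω x') ≤
      σ * (1 - η₀ + ς * η₀) *
        weightedDist (N.nodes n) ς (fun _ => 1 / (n : ℝ)) x x' := by
  have hA := sum_aggSmall_add_aggBig_le (N := N) (n := n) (ω := ω) hς1 h.ηsb_mem
    (a := fun j => |N.perf ω x j - N.perf ω x' j|) fun _ => abs_nonneg _
  have hB := h.mean_abs_perf_sub_le hγ1 hσ hς hfb hn x x'
  have hκ : 0 ≤ 1 - η₀ + ς * η₀ := by nlinarith
  calc weightedDist (N.nodes n) ς (fun _ => 1 / (n : ℝ)) (N.aggMap n ω x) (N.aggMap n ω x')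
      ≤ ς * N.aggBig n ω (fun j => |N.perf ω x j - N.perf ω x' j|) +
        ∑ i ∈ N.nodes n, 1 / (n : ℝ) *
          N.aggSmall n ω (fun j => |N.perf ω x j - N.perf ω x' j|) i := by
        refine add_le_add (mul_le_mul_of_nonneg_left (abs_aggBig_sub_le _ _
          fun j => hη₀.trans (h.ηsb_mem j).1) hς) (Finset.sum_le_sum fun i hi => ?_)
        have hi' : i.2 < N.groupSize n i.1 := mem_nodes.1 hi
        simp only [aggMap, if_pos hi']
        exact mul_le_mul_of_nonneg_left
          (abs_aggSmall_sub_le _ _ fun j => h.weight_nonneg n j i) (by positivity)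
    _ ≤ (1 - η₀ + ς * η₀) * (σ * weightedDist (N.nodes n) ς (fun _ => 1 / (n : ℝ)) x x') :=
        hA.trans (mul_le_mul_of_nonneg_left hB hκ)
    _ = _ := by ring

theorem RegularPath.existsUnique_aggMap {σ ς η₀ : ℝ} (hγ1 : N.γ < 1) (hσ : 0 ≤ σ)
    (hς : 0 < ς) (hς1 : ς ≤ 1) (hη₀ : 0 ≤ η₀) (hη₁ : η₀ ≤ 1)
    (hκ : σ * (1 - η₀ + ς * η₀) < 1)
    (hfb : ∀ x u, |N.fb x - N.fb u| ≤ |x - u|) {ω : Ω} (h : N.RegularPath σ ς η₀ ω) {n : ℕ}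
    (hn : N.Admissible n) : ∃! x, N.aggMap n ω x = x := by
  have hn0 : (0 : ℝ) < n := by exact_mod_cast hn.1
  refine existsUnique_fixed_of_weightedDist_le (S := N.nodes n) hς
    (w := fun _ => 1 / (n : ℝ)) (fun i _ => by positivity) hκ (fun x i hi => ?_)
    (h.weightedDist_aggMap_le hγ1 hσ hς.le hς1 hη₀ hη₁ hfb hn)
  exact if_neg fun hi' => hi (mem_nodes.2 hi')

theorem nodeSum_congr {n : ℕ} {a b : Node → ℝ} (h : ∀ i ∈ N.nodes n, a i = b i) :
    N.nodeSum n a = N.nodeSum n b := by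
  rw [nodeSum_eq_sum_nodes, nodeSum_eq_sum_nodes]
  exact Finset.sum_congr rfl h

theorem aggSmall_congr {n : ℕ} {ω : Ω} {a b : Node → ℝ} (h : ∀ i ∈ N.nodes n, a i = b i)
    (i : Node) : N.aggSmall n ω a i = N.aggSmall n ω b i :=
  nodeSum_congr fun j hj => by rw [h j hj]

theorem aggBig_congr {n : ℕ} {ω : Ω} {a b : Node → ℝ} (h : ∀ i ∈ N.nodes n, a i = b i) :
    N.aggBig n ω a = N.aggBig n ω b := by
  rw [aggBig, aggBig, nodeSum_congr fun j hj => by rw [h j hj]]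

theorem aggMap_eq_aggregate {n : ℕ} {ω : Ω} {X x : State}
    (hX : ∀ i ∈ N.nodes n, X.2 i = N.perf ω x i) : N.aggMap n ω x = N.aggregate n ω X := by
  refine Prod.ext (aggBig_congr fun i hi => (hX i hi).symm) (funext fun i => ?_)
  simp only [aggMap, aggregate]
  split_ifs
  · exact aggSmall_congr (fun i hi => (hX i hi).symm) i
  · rfl

theorem aggMap_aggregate {n : ℕ} {ω : Ω} {X : State} (hX : N.perfMap n ω X = X) :
    N.aggMap n ω (N.aggregate n ω X) = N.aggregate n ω X := by
  refine aggMap_eq_aggregate fun i hi => ?_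
  have hi' := mem_nodes.1 hi
  have h1 : N.fb (N.aggBig n ω X.2) = X.1 := congrArg Prod.fst hX
  have h2 := congrFun (congrArg Prod.snd hX) i
  simp only [perfMap, if_pos hi'] at h2
  simp only [perf, aggregate, if_pos hi', h1]
  exact h2.symm

/-- The fixed points of the network map and of the aggregate map determine each other. -/
theorem existsUnique_perfMap {n : ℕ} {ω : Ω} (h : ∃! x, N.aggMap n ω x = x) :
    ∃! X, N.perfMap n ω X = X := by
  obtain ⟨x, hx, hu⟩ := h
  set X : State := (N.fb x.1, fun i => if i.2 < N.groupSize n i.1 then N.perf ω x i else 0)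
    with hXdef
  have hXx : N.aggregate n ω X = x := by
    rw [← aggMap_eq_aggregate (x := x), hx]
    intro i hi
    simp only [hXdef, if_pos (mem_nodes.1 hi)]
  have key : ∀ Y : State, N.aggregate n ω Y = x → Y.1 = N.fb x.1 → N.perfMap n ω Y = X := by
    intro Y hY hY1
    have h1 : N.aggBig n ω Y.2 = x.1 := congrArg Prod.fst hY
    refine Prod.ext (congrArg N.fb h1) (funext fun i => ?_)
    have h2 := congrFun (congrArg Prod.snd hY) i
    simp only [aggregate] at h2
    simp only [perfMap, hXdef, perf]
    split_ifs with hi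
    · rw [if_pos hi] at h2
      rw [h2, hY1]
    · rfl
  refine ⟨X, key X hXx rfl, fun Y hY => ?_⟩
  have hYx : N.aggregate n ω Y = x := hu _ (aggMap_aggregate hY)
  have h1 : N.aggBig n ω Y.2 = x.1 := congrArg Prod.fst hYx
  rw [← key Y hYx (by rw [← h1]; exact (congrArg Prod.fst hY).symm), hY]

/-! ### Aggregates of averages -/

/-- The total error made by replacing the inverse out-degrees by their limiting equivalents. -/
noncomputable def outDegreeError (N : Network Ω 𝓖) (n : ℕ) (ω : Ω) : ℝ :=
  ∑ s : Fin 2, ∑ k ∈ Finset.range (N.groupSize n s),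
    |1 / N.outDegree n (s, k) ω - 1 / (n * N.γp s)|

theorem RegularPath.tendsto_outDegreeError {σ ς η₀ : ℝ} {ω : Ω} (h : N.RegularPath σ ς η₀ ω) :
    Tendsto (fun n => N.outDegreeError n ω) N.sizes (𝓝 0) := by
  simpa [outDegreeError] using (h.growth 0).add (h.growth 1)

theorem RegularPath.abs_aggSmall_sub_le_outDegreeError {σ ς η₀ : ℝ} (hη₀ : 0 ≤ η₀) {ω : Ω}
    (h : N.RegularPath σ ς η₀ ω) (n : ℕ) {a : Node → ℝ} {C : ℝ} (ha : ∀ j, |a j| ≤ C) (i : Node) :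
    |N.aggSmall n ω a i - ∑ s : Fin 2, 1 / (n * N.γp s) *
      ∑ k ∈ Finset.range (N.groupSize n s),
        a (s, k) * (1 - N.ηsb (s, k) ω) * N.edge (s, k) i ω| ≤ C * N.outDegreeError n ω := by
  simp only [aggSmall, nodeSum, outDegreeError, ← Finset.sum_sub_distrib, Finset.mul_sum]
  refine (Finset.abs_sum_le_sum_abs _ _).trans (Finset.sum_le_sum fun s _ => ?_)
  refine (Finset.abs_sum_le_sum_abs _ _).trans (Finset.sum_le_sum fun k _ => ?_)
  have e : a (s, k) * N.weight n (s, k) i ω - 1 / (n * N.γp s) *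
      (a (s, k) * (1 - N.ηsb (s, k) ω) * N.edge (s, k) i ω) =
      a (s, k) * ((1 - N.ηsb (s, k) ω) * N.edge (s, k) i ω) *
        (1 / N.outDegree n (s, k) ω - 1 / (n * N.γp s)) := by
    rw [weight]; ring
  have hC : 0 ≤ C := (abs_nonneg _).trans (ha (s, k))
  obtain ⟨e1, e2⟩ := h.edge_mem (s, k) i
  obtain ⟨d1, d2⟩ := h.ηsb_mem (s, k)
  rw [e, abs_mul, abs_mul]
  refine mul_le_mul_of_nonneg_right ?_ (abs_nonneg _)
  have h1 : |(1 - N.ηsb (s, k) ω) * N.edge (s, k) i ω| ≤ 1 := by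
    rw [abs_of_nonneg (mul_nonneg (by linarith) e1)]
    exact mul_le_one₀ (by linarith) e1 e2
  exact (mul_le_mul (ha _) h1 (abs_nonneg _) hC).trans_eq (mul_one C)

/-- If the partial sums that the first `n` small nodes receive from each group are uniformly close
to `n_s e_s (1 - p^{sb}_s) p_{sm}`, then so are the aggregates to their limits. -/
theorem RegularPath.eventually_abs_aggSmall_sub_le {σ ς η₀ : ℝ} (hη₀ : 0 ≤ η₀) (hγ1 : N.γ < 1)
    (hγp : ∀ s, 0 < N.γp s) {ω : Ω} (h : N.RegularPath σ ς η₀ ω) {a : Node → ℝ} {C : ℝ}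
    (ha : ∀ j, |a j| ≤ C) {e : Fin 2 → ℝ} {m : Fin 2}
    (hsum : ∀ s, ∀ ε > 0, ∀ᶠ n : ℕ in atTop, ∀ i < n,
      |∑ k ∈ Finset.range (N.groupSize n s),
        a (s, k) * (1 - N.ηsb (s, k) ω) * N.edge (s, k) (m, i) ω -
        N.groupSize n s * (e s * N.edgeProb s m)| ≤ ε * n) {ε : ℝ} (hε : 0 < ε) :
    ∀ᶠ n : ℕ in N.sizes, ∀ i < n,
      |N.aggSmall n ω a (m, i) - ∑ s : Fin 2, N.frac s * N.edgeProb s m / N.γp s * e s| ≤ ε := by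
  have hle : N.sizes ≤ atTop := inf_le_left
  have hadm : ∀ᶠ n in N.sizes, N.Admissible n := mem_inf_of_right (mem_principal_self _)
  have herr : ∀ᶠ n in N.sizes, C * N.outDegreeError n ω < ε / 2 := by
    have := h.tendsto_outDegreeError.const_mul C
    rw [mul_zero] at this
    exact this.eventually_lt_const (by positivity)
  have hs : ∀ᶠ n : ℕ in N.sizes, ∀ s, ∀ i < n,
      |∑ k ∈ Finset.range (N.groupSize n s),
        a (s, k) * (1 - N.ηsb (s, k) ω) * N.edge (s, k) (m, i) ω -
        N.groupSize n s * (e s * N.edgeProb s m)| ≤ ε / 4 * N.γp s * n :=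
    eventually_all.2 fun s => hle (hsum s _ (mul_pos (by positivity) (hγp s)))
  filter_upwards [hadm, herr, hs] with n hn hn1 hn2 i hi
  have hn0 : (0 : ℝ) < n := by exact_mod_cast hn.1
  have h1 := h.abs_aggSmall_sub_le_outDegreeError hη₀ n ha (m, i)
  have h2 : |∑ s : Fin 2, 1 / (n * N.γp s) * ∑ k ∈ Finset.range (N.groupSize n s),
        a (s, k) * (1 - N.ηsb (s, k) ω) * N.edge (s, k) (m, i) ω -
      ∑ s : Fin 2, N.frac s * N.edgeProb s m / N.γp s * e s| ≤ ∑ _s : Fin 2, ε / 4 := by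
    rw [← Finset.sum_sub_distrib]
    refine (Finset.abs_sum_le_sum_abs _ _).trans (Finset.sum_le_sum fun s _ => ?_)
    have hγ := hγp s
    have hg := hn2 s i hi
    rw [groupSize_of_admissible hγ1 hn] at hg
    have e1 : 1 / (n * N.γp s) * (∑ k ∈ Finset.range (N.groupSize n s),
          a (s, k) * (1 - N.ηsb (s, k) ω) * N.edge (s, k) (m, i) ω) -
        N.frac s * N.edgeProb s m / N.γp s * e s =
        1 / (n * N.γp s) * (∑ k ∈ Finset.range (N.groupSize n s),
          a (s, k) * (1 - N.ηsb (s, k) ω) * N.edge (s, k) (m, i) ω -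
          n * N.frac s * (e s * N.edgeProb s m)) := by
      field_simp
    rw [e1, abs_mul, abs_of_pos (by positivity)]
    refine (mul_le_mul_of_nonneg_left hg (by positivity)).trans_eq ?_
    field_simp
  simp only [Finset.sum_const, Finset.card_univ, Fintype.card_fin, nsmul_eq_mul] at h2
  refine (abs_sub_le _ _ _).trans ((add_le_add h1 h2).trans ?_)
  push_cast
  linarith

theorem tendsto_aggBig (hγ1 : N.γ < 1) {ω : Ω} {a : Node → ℝ} {e : Fin 2 → ℝ}
    (hsum : ∀ s, ∀ ε > 0, ∀ᶠ n : ℕ in atTop,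
      |∑ k ∈ Finset.range (N.groupSize n s), a (s, k) * N.ηsb (s, k) ω -
        N.groupSize n s * e s| ≤ ε * n) :
    Tendsto (fun n => N.aggBig n ω a) N.sizes (𝓝 (∑ s : Fin 2, N.frac s * e s)) := by
  have hle : N.sizes ≤ atTop := inf_le_left
  have hadm : ∀ᶠ n in N.sizes, N.Admissible n := mem_inf_of_right (mem_principal_self _)
  rw [Metric.tendsto_nhds]
  intro ε hε
  have hs : ∀ᶠ n : ℕ in N.sizes, ∀ s,
      |∑ k ∈ Finset.range (N.groupSize n s), a (s, k) * N.ηsb (s, k) ω -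
        N.groupSize n s * e s| ≤ ε / 4 * n :=
    eventually_all.2 fun s => hle (hsum s _ (by positivity))
  filter_upwards [hadm, hs] with n hn hn2
  have hn0 : (0 : ℝ) < n := by exact_mod_cast hn.1
  rw [Real.dist_eq, aggBig, nodeSum, Finset.mul_sum, ← Finset.sum_sub_distrib]
  refine (Finset.abs_sum_le_sum_abs _ _).trans_lt ?_
  calc _ ≤ ∑ _s : Fin 2, ε / 4 := by
        refine Finset.sum_le_sum fun s _ => ?_
        have hg := hn2 s
        rw [groupSize_of_admissible hγ1 hn] at hg
        have e1 : 1 / (n : ℝ) * (∑ k ∈ Finset.range (N.groupSize n s),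
            a (s, k) * N.ηsb (s, k) ω) - N.frac s * e s =
            1 / (n : ℝ) * (∑ k ∈ Finset.range (N.groupSize n s),
            a (s, k) * N.ηsb (s, k) ω - n * N.frac s * e s) := by
          field_simp
        rw [e1, abs_mul, abs_of_pos (by positivity)]
        refine (mul_le_mul_of_nonneg_left hg (by positivity)).trans_eq ?_
        field_simp
    _ < ε := by simp; linarith

end Network
namespace Network

/-! ### The three-dimensional system -/

section threeDim

variable {Ω : Type*} {𝓖 : Fin 2 → Type*} {N : Network Ω 𝓖}

theorem sum_frac : ∑ s : Fin 2, N.frac s = 1 := by simp [frac]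

theorem BoundedContinuous.measurable_f [∀ m, TopologicalSpace (𝓖 m)]
    [∀ m, MeasurableSpace (𝓖 m)] [∀ m, BorelSpace (𝓖 m)] {y : ℝ}
    (h1 : N.BoundedContinuous y) (x : Fin 2 → ℝ) (xb : ℝ) (s : Fin 2) :
    Measurable (Function.uncurry fun (g : 𝓖 s) e =>
      N.f s g (x s) (e * xb)) :=
  ((h1.continuous_f s).comp
    (by fun_prop : Continuous fun q : 𝓖 s × ℝ => (q.1, x s, q.2 * xb))).measurable

variable [MeasurableSpace Ω] {P : Measure Ω}

theorem received_le (m : Fin 2) :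
    N.received P m ≤ max (N.received P 1) (N.received P 0) := by
  fin_cases m
  exacts [le_max_right _ _, le_max_left _ _]

variable [∀ m, MeasurableSpace (𝓖 m)]

theorem IsModel.frac_pos (hN : N.IsModel P) (s : Fin 2) : 0 < N.frac s := by
  unfold frac
  split_ifs
  exacts [hN.γ_pos, sub_pos.2 hN.γ_lt_one]

theorem IsModel.edgeProb_nonneg (hN : N.IsModel P) (s t : Fin 2) : 0 ≤ N.edgeProb s t := by
  rw [← hN.edge_prob (s, 0) (t, 0)]
  exact measureReal_nonneg

theorem IsModel.psb_mem [IsProbabilityMeasure P] (hN : N.IsModel P) {η₀ : ℝ}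
    (hη : ∀ j, ∀ᵐ ω ∂P, η₀ ≤ N.ηsb j ω) (s : Fin 2) : N.psb P s ∈ Set.Icc η₀ 1 := by
  have hi : Integrable (N.ηsb (s, 0)) P :=
    Integrable.of_mem_Icc 0 1 (hN.measurable_ηsb _).aemeasurable (hN.ηsb_mem _)
  constructor
  · simpa [psb] using integral_mono_ae (integrable_const η₀) hi (hη (s, 0))
  · simpa [psb] using integral_mono_ae hi (integrable_const (1 : ℝ))
      ((hN.ηsb_mem (s, 0)).mono fun _ h => h.2)

theorem sum_frac_mul_psb_mem [IsProbabilityMeasure P] (hN : N.IsModel P) {η₀ : ℝ}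
    (hη : ∀ j, ∀ᵐ ω ∂P, η₀ ≤ N.ηsb j ω) :
    ∑ s : Fin 2, N.frac s * N.psb P s ∈ Set.Icc η₀ 1 := by
  have h := sum_frac (N := N)
  constructor
  · calc η₀ = ∑ s : Fin 2, N.frac s * η₀ := by rw [← Finset.sum_mul, h, one_mul]
      _ ≤ _ := Finset.sum_le_sum fun s _ =>
        mul_le_mul_of_nonneg_left (hN.psb_mem hη s).1 (hN.frac_pos s).le
  · calc _ ≤ ∑ s : Fin 2, N.frac s * 1 := Finset.sum_le_sum fun s _ =>
        mul_le_mul_of_nonneg_left (hN.psb_mem hη s).2 (hN.frac_pos s).le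
      _ = 1 := by rw [← Finset.sum_mul, h, one_mul]

variable [∀ m, TopologicalSpace (𝓖 m)] [∀ m, BorelSpace (𝓖 m)]

theorem BoundedContinuous.measurable_ξ {y : ℝ} (h1 : N.BoundedContinuous y) (hN : N.IsModel P)
    (i : Node) (x xb : ℝ) : Measurable fun ω => N.ξ i ω x xb :=
  hN.measurable_nodeFun (F := fun s g e => N.f s g x (e * xb))
    (h1.measurable_f (fun _ => x) xb) i

theorem BoundedContinuous.meanξ_mem [IsProbabilityMeasure P] {y : ℝ} (h1 : N.BoundedContinuous y)
    (hN : N.IsModel P) (m : Fin 2) (x xb : ℝ) : N.meanξ P m x xb ∈ Set.Icc 0 y := by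
  have hi : Integrable (fun ω => N.ξ (m, 0) ω x xb) P :=
    Integrable.of_mem_Icc 0 y (h1.measurable_ξ hN _ x xb).aemeasurable
      (Eventually.of_forall fun ω => h1.f_mem _ _ _ _)
  refine ⟨integral_nonneg fun ω => (h1.f_mem _ _ _ _).1, ?_⟩
  simpa [meanξ] using integral_mono hi (integrable_const y) fun ω => (h1.f_mem _ _ _ _).2

theorem abs_meanξ_sub_le [IsProbabilityMeasure P] {y σ ς : ℝ} (h1 : N.BoundedContinuous y)
    (hN : N.IsModel P) (h3 : N.LipschitzBound P σ ς) (m : Fin 2) (x xb u ub : ℝ) :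
    |N.meanξ P m x xb - N.meanξ P m u ub| ≤ σ * (|x - u| + ς * |xb - ub|) := by
  have hi : ∀ x xb, Integrable (fun ω => N.ξ (m, 0) ω x xb) P := fun x xb =>
    Integrable.of_mem_Icc 0 y (h1.measurable_ξ hN _ x xb).aemeasurable
      (Eventually.of_forall fun ω => h1.f_mem _ _ _ _)
  rw [meanξ, meanξ, ← integral_sub (hi _ _) (hi _ _)]
  have := norm_integral_le_of_norm_le_const (μ := P)
    (f := fun ω => N.ξ (m, 0) ω x xb - N.ξ (m, 0) ω u ub)
    (C := σ * (|x - u| + ς * |xb - ub|))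
    ((h3.lipschitz_ξ (m, 0)).mono fun ω hω => hω x xb u ub)
  simpa using this

/-- The three-dimensional map is a contraction for the limit of the distances for which the
aggregate maps are: a group counts in proportion to its size, and the big node with weight `ς`. -/
theorem weightedDist_threeDimMap_le [IsProbabilityMeasure P] {y σ ς η₀ : ℝ}
    (hN : N.IsModel P) (h1 : N.BoundedContinuous y) (hγp : ∀ s, 0 < N.γp s)
    (h3 : N.LipschitzBound P σ ς) (hσ : 0 ≤ σ) (hη₀ : 0 ≤ η₀)
    (hη : ∀ j, ∀ᵐ ω ∂P, η₀ ≤ N.ηsb j ω) (z w : ℝ × (Fin 2 → ℝ)) :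
    weightedDist Finset.univ ς N.frac (N.threeDimMap P z) (N.threeDimMap P w) ≤
      σ * (1 - η₀ + ς * η₀) * weightedDist Finset.univ ς N.frac z w := by
  set d : Fin 2 → ℝ := fun s =>
    |N.meanξ P s (z.2 s) (N.fb z.1) - N.meanξ P s (w.2 s) (N.fb w.1)| with hd
  have hd0 : ∀ s, 0 ≤ d s := fun s => abs_nonneg _
  have hς := h3.ς_pos.le
  have hf := fun s => (hN.frac_pos s).le
  have hp := fun s => hN.psb_mem hη s
  have b1 : |(N.threeDimMap P z).1 - (N.threeDimMap P w).1| ≤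
      ∑ s : Fin 2, N.frac s * d s * N.psb P s := by
    simp only [threeDimMap, ← Finset.sum_sub_distrib, ← sub_mul, ← mul_sub]
    refine (Finset.abs_sum_le_sum_abs _ _).trans_eq (Finset.sum_congr rfl fun s _ => ?_)
    rw [abs_mul, abs_mul, abs_of_nonneg (hf s), abs_of_nonneg (hη₀.trans (hp s).1)]
  have b2 : ∀ m, |(N.threeDimMap P z).2 m - (N.threeDimMap P w).2 m| ≤
      ∑ s : Fin 2, d s * (N.frac s * N.edgeProb s m / N.γp s) * (1 - N.psb P s) := by
    intro m
    simp only [threeDimMap, ← Finset.sum_sub_distrib, ← sub_mul]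
    refine (Finset.abs_sum_le_sum_abs _ _).trans_eq (Finset.sum_congr rfl fun s _ => ?_)
    have : 0 ≤ N.frac s * N.edgeProb s m / N.γp s :=
      div_nonneg (mul_nonneg (hf s) (hN.edgeProb_nonneg s m)) (hγp s).le
    rw [abs_mul, abs_mul, abs_of_nonneg this, abs_of_nonneg (sub_nonneg.2 (hp s).2)]
  have b3 : ∀ s, d s ≤ σ * (|z.2 s - w.2 s| + ς * |z.1 - w.1|) := fun s =>
    (abs_meanξ_sub_le h1 hN h3 s _ _ _ _).trans (mul_le_mul_of_nonneg_left
      (add_le_add le_rfl (mul_le_mul_of_nonneg_left (h3.lipschitz_fb _ _) hς)) hσ)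
  have hκ : 0 ≤ 1 - η₀ + ς * η₀ := by
    nlinarith [(hp 0).1.trans (hp 0).2]
  calc weightedDist Finset.univ ς N.frac (N.threeDimMap P z) (N.threeDimMap P w)
      ≤ ς * ∑ s : Fin 2, N.frac s * d s * N.psb P s + ∑ m : Fin 2, N.frac m *
          ∑ s : Fin 2, d s * (N.frac s * N.edgeProb s m / N.γp s) * (1 - N.psb P s) :=
        add_le_add (mul_le_mul_of_nonneg_left b1 hς) (Finset.sum_le_sum fun m _ =>
          mul_le_mul_of_nonneg_left (b2 m) (hf m))
    _ = ∑ s : Fin 2, N.frac s * d s * (1 - N.psb P s + ς * N.psb P s) := by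
        have : ∑ m : Fin 2, N.frac m *
            ∑ s : Fin 2, d s * (N.frac s * N.edgeProb s m / N.γp s) * (1 - N.psb P s) =
            ∑ s : Fin 2, N.frac s * d s * (1 - N.psb P s) := by
          simp only [Finset.mul_sum]
          rw [Finset.sum_comm]
          refine Finset.sum_congr rfl fun s _ => ?_
          have hs : N.γp s / N.γp s = 1 := div_self (hγp s).ne'
          calc _ = N.frac s * d s * (1 - N.psb P s) *
                ((∑ m : Fin 2, N.frac m * N.edgeProb s m) / N.γp s) := by
                rw [Finset.sum_div, Finset.mul_sum]
                exact Finset.sum_congr rfl fun m _ => by ring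
            _ = _ := by rw [← γp, hs, mul_one]
        rw [this, Finset.mul_sum, ← Finset.sum_add_distrib]
        exact Finset.sum_congr rfl fun s _ => by ring
    _ ≤ ∑ s : Fin 2, N.frac s * (σ * (|z.2 s - w.2 s| + ς * |z.1 - w.1|)) *
          (1 - η₀ + ς * η₀) := by
        refine Finset.sum_le_sum fun s _ => ?_
        refine mul_le_mul (mul_le_mul_of_nonneg_left (b3 s) (hf s)) ?_ ?_ ?_
        · nlinarith [(hp s).1, h3.ς_le_one]
        · nlinarith [(hp s).1, (hp s).2]
        · exact mul_nonneg (hf s) ((hd0 s).trans (b3 s))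
    _ = σ * (1 - η₀ + ς * η₀) * (ς * |z.1 - w.1| * ∑ s : Fin 2, N.frac s +
          ∑ s : Fin 2, N.frac s * |z.2 s - w.2 s|) := by
        rw [Finset.mul_sum, ← Finset.sum_add_distrib, Finset.mul_sum]
        exact Finset.sum_congr rfl fun s _ => by ring
    _ = _ := by rw [sum_frac, mul_one, weightedDist]

theorem fst_mem_of_threeDimMap_eq [IsProbabilityMeasure P] {y η₀ : ℝ} (hy : 0 ≤ y)
    (hN : N.IsModel P) (h1 : N.BoundedContinuous y) (hη₀ : 0 ≤ η₀)
    (hη : ∀ j, ∀ᵐ ω ∂P, η₀ ≤ N.ηsb j ω) {z : ℝ × (Fin 2 → ℝ)} (hz : N.threeDimMap P z = z) :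
    z.1 ∈ Set.Icc 0 y := by
  rw [← hz]
  simp only [threeDimMap]
  have hm := fun s => h1.meanξ_mem hN s (z.2 s) (N.fb z.1)
  have hp := fun s => (hη₀.trans (hN.psb_mem hη s).1)
  have hf := fun s => (hN.frac_pos s).le
  refine ⟨Finset.sum_nonneg fun s _ => mul_nonneg (mul_nonneg (hf s) (hm s).1) (hp s), ?_⟩
  calc _ ≤ ∑ s : Fin 2, N.frac s * N.psb P s * y := Finset.sum_le_sum fun s _ => by
        rw [mul_right_comm]
        exact mul_le_mul_of_nonneg_left (hm s).2 (mul_nonneg (hf s) (hp s))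
    _ ≤ y := by
        rw [← Finset.sum_mul]
        exact mul_le_of_le_one_left hy (sum_frac_mul_psb_mem hN hη).2

theorem snd_mem_of_threeDimMap_eq [IsProbabilityMeasure P] {y η₀ : ℝ} (hy : 0 ≤ y)
    (hN : N.IsModel P) (h1 : N.BoundedContinuous y) (hγp : ∀ s, 0 < N.γp s)
    (h4 : N.MeanWeightBound P) (hη₀ : 0 ≤ η₀)
    (hη : ∀ j, ∀ᵐ ω ∂P, η₀ ≤ N.ηsb j ω) {z : ℝ × (Fin 2 → ℝ)} (hz : N.threeDimMap P z = z)
    (m : Fin 2) : z.2 m ∈ Set.Icc 0 y := by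
  rw [← hz]
  simp only [threeDimMap]
  have hm := fun s => h1.meanξ_mem hN s (z.2 s) (N.fb z.1)
  have hp := fun s => sub_nonneg.2 (hN.psb_mem hη s).2
  have hw : ∀ s, 0 ≤ N.frac s * N.edgeProb s m / N.γp s := fun s =>
    div_nonneg (mul_nonneg (hN.frac_pos s).le (hN.edgeProb_nonneg s m)) (hγp s).le
  refine ⟨Finset.sum_nonneg fun s _ => mul_nonneg (mul_nonneg (hm s).1 (hw s)) (hp s), ?_⟩
  have hr : N.received P m ≤ 1 := by
    have h5 : N.ϱ P ≤ 1 := h4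
    rw [ϱ] at h5
    linarith [received_le (N := N) (P := P) m, (sum_frac_mul_psb_mem hN hη).1]
  calc _ ≤ ∑ s : Fin 2, y * (N.frac s * N.edgeProb s m * (1 - N.psb P s) / N.γp s) :=
        Finset.sum_le_sum fun s _ => by
          have := mul_le_mul_of_nonneg_right (hm s).2 (mul_nonneg (hw s) (hp s))
          calc _ = _ := mul_assoc _ _ _
            _ ≤ _ := this
            _ = _ := by ring
    _ ≤ y := by
        rw [← Finset.mul_sum]
        exact mul_le_of_le_one_right hy hr

end threeDim

section paths

variable {Ω : Type*} {𝓖 : Fin 2 → Type*} {N : Network Ω 𝓖}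

/-! ### Limits on sample paths -/

/-- The sample paths on which the aggregates of the performances at `z`, and the weights that the
nodes receive, converge: those of the small nodes uniformly over the network.  Here `r m` and `q`
are the limits of the total weights received by a small node of group `m` and by the big node. -/
structure ConvergentPath (N : Network Ω 𝓖) (r : Fin 2 → ℝ) (q : ℝ) (z : ℝ × (Fin 2 → ℝ))
    (ω : Ω) : Prop where
  aggSmall_perf : ∀ m, ∀ ε > 0, ∀ᶠ n : ℕ in N.sizes, ∀ i < n,
    |N.aggSmall n ω (N.perf ω (constState z)) (m, i) - z.2 m| ≤ ε
  aggSmall_one : ∀ m, ∀ ε > 0, ∀ᶠ n : ℕ in N.sizes, ∀ i < n,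
    |N.aggSmall n ω (fun _ => 1) (m, i) - r m| ≤ ε
  aggBig_perf : Tendsto (fun n => N.aggBig n ω (N.perf ω (constState z))) N.sizes (𝓝 z.1)
  aggBig_one : Tendsto (fun n => N.aggBig n ω (fun _ => 1)) N.sizes (𝓝 q)

theorem eventually_admissible : ∀ᶠ n in N.sizes, N.Admissible n :=
  mem_inf_of_right (mem_principal_self _)

theorem sizes_neBot (h : ∃ n, N.Admissible n) : N.sizes.NeBot := by
  obtain ⟨n, hn, k, hk⟩ := h
  refine (frequently_mem_iff_neBot (l := atTop) (s := {n | N.Admissible n})).1 ?_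
  refine frequently_atTop.2 fun a => ⟨(a + 1) * n, ?_, by positivity, (a + 1) * k, ?_⟩
  · nlinarith
  · push_cast
    rw [hk]
    ring

theorem eventually_lt_groupSize (hγ0 : 0 < N.γ) (hγ1 : N.γ < 1) (m : Fin 2) (i : ℕ) :
    ∀ᶠ n in N.sizes, i < N.groupSize n m := by
  have hf : 0 < N.frac m := by
    unfold frac
    split_ifs
    exacts [hγ0, sub_pos.2 hγ1]
  have h : ∀ᶠ n : ℕ in N.sizes, (i : ℝ) / N.frac m < n :=
    (tendsto_natCast_atTop_atTop.eventually_gt_atTop _).filter_mono inf_le_left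
  filter_upwards [h, eventually_admissible] with n hn hadm
  have := groupSize_of_admissible hγ1 hadm m
  rw [div_lt_iff₀ hf] at hn
  exact_mod_cast (this ▸ hn : (i : ℝ) < N.groupSize n m)

theorem tendsto_of_eventually_forall_le {a : ℕ → ℕ → ℝ} {l : ℝ}
    (h : ∀ ε > 0, ∀ᶠ n in N.sizes, ∀ i < n, |a n i - l| ≤ ε) (i : ℕ) :
    Tendsto (fun n => a n i) N.sizes (𝓝 l) := by
  rw [Metric.tendsto_nhds]
  intro ε hε
  have hlt : ∀ᶠ n in N.sizes, i < n := (eventually_gt_atTop i).filter_mono inf_le_left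
  filter_upwards [h (ε / 2) (by positivity), hlt] with n hn hi
  rw [Real.dist_eq]
  linarith [hn i hi]

theorem ConvergentPath.tendsto_aggMap_snd (hγ0 : 0 < N.γ) (hγ1 : N.γ < 1) {r : Fin 2 → ℝ} {q : ℝ}
    {z : ℝ × (Fin 2 → ℝ)} {ω : Ω} (hc : N.ConvergentPath r q z ω) (i : Node) :
    Tendsto (fun n => (N.aggMap n ω (constState z)).2 i) N.sizes (𝓝 (z.2 i.1)) := by
  refine (tendsto_of_eventually_forall_le (hc.aggSmall_perf i.1) i.2).congr' ?_
  filter_upwards [eventually_lt_groupSize hγ0 hγ1 i.1 i.2] with n hn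
  exact (if_pos hn).symm

theorem ConvergentPath.limitMap_constState (hγ0 : 0 < N.γ) (hγ1 : N.γ < 1)
    (hadm : ∃ n, N.Admissible n) {r : Fin 2 → ℝ} {q : ℝ}
    {z : ℝ × (Fin 2 → ℝ)} {ω : Ω} (hc : N.ConvergentPath r q z ω) :
    N.limitMap ω (constState z) = constState z := by
  have := sizes_neBot hadm
  exact Prod.ext hc.aggBig_perf.limsup_eq
    (funext fun i => (hc.tendsto_aggMap_snd hγ0 hγ1 i).limsup_eq)

theorem abs_limsup_sub_le {ι : Type*} {l : Filter ι} [l.NeBot] {a b c : ι → ℝ} {β δ : ℝ}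
    (h : ∀ᶠ n in l, |a n - b n| ≤ c n) (hb : Tendsto b l (𝓝 β)) (hc : Tendsto c l (𝓝 δ)) :
    |limsup a l - β| ≤ δ := by
  have hu : ∀ᶠ n in l, a n ≤ b n + c n := h.mono fun n hn => by linarith [(abs_le.1 hn).2]
  have hl : ∀ᶠ n in l, b n - c n ≤ a n := h.mono fun n hn => by linarith [(abs_le.1 hn).1]
  have hadd := hb.add hc
  have hsub := hb.sub hc
  have bu : l.IsBoundedUnder (· ≤ ·) a := hadd.isBoundedUnder_le.mono_le hu
  have bl : l.IsBoundedUnder (· ≥ ·) a := hsub.isBoundedUnder_ge.mono_ge hl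
  have h1 : limsup a l ≤ β + δ := hadd.limsup_eq ▸
    limsup_le_limsup hu bl.isCoboundedUnder_le hadd.isBoundedUnder_le
  have h2 : β - δ ≤ limsup a l := hsub.limsup_eq ▸
    limsup_le_limsup hl hsub.isBoundedUnder_ge.isCoboundedUnder_le bu
  exact abs_le.2 ⟨by linarith, by linarith⟩

/-- Uniqueness for the limit map: unlike for finite networks, the contraction is seen in the
supremum over the small nodes, with weight `ς` for the big node. -/
theorem ConvergentPath.eq_constState_of_limitMap_eq (hγ0 : 0 < N.γ) (hγ1 : N.γ < 1)
    (hadm : ∃ n, N.Admissible n) {σ ς η₀ y : ℝ} (hσ : 0 ≤ σ) (hς : 0 < ς) (hς1 : ς ≤ 1)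
    (hη₀ : 0 ≤ η₀) (hκ : σ * (1 - η₀ + ς * η₀) < 1)
    (hfb : ∀ x u, |N.fb x - N.fb u| ≤ |x - u|) {r : Fin 2 → ℝ} {q : ℝ} (hq : η₀ ≤ q)
    (hr : ∀ m, r m + q ≤ 1) {z : ℝ × (Fin 2 → ℝ)} (hz : ∀ m, z.2 m ∈ Set.Icc 0 y) {ω : Ω}
    (h : N.RegularPath σ ς η₀ ω) (hc : N.ConvergentPath r q z ω)
    {w : State} (hw : ∀ i, w.2 i ∈ Set.Icc 0 y) (hfix : N.limitMap ω w = w) :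
    w = constState z := by
  have := sizes_neBot hadm
  set D : ℝ := ⨆ i : Node, |w.2 i - z.2 i.1|
  have hbdd : BddAbove (Set.range fun i : Node => |w.2 i - z.2 i.1|) := by
    refine ⟨y, ?_⟩
    rintro _ ⟨i, rfl⟩
    have h1 := hw i
    have h2 := hz i.1
    exact abs_le.2 ⟨by linarith [h1.1, h2.2], by linarith [h1.2, h2.1]⟩
  have hD : ∀ i : Node, |w.2 i - z.2 i.1| ≤ D := le_ciSup hbdd
  set B : ℝ := |w.1 - z.1|
  have hB : 0 ≤ B := abs_nonneg _
  have hD0 : 0 ≤ D := (abs_nonneg _).trans (hD (0, 0))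
  set E := D + ς * B
  have hE : 0 ≤ E := add_nonneg hD0 (mul_nonneg hς.le hB)
  have hperf : ∀ j, |N.perf ω w j - N.perf ω (constState z) j| ≤ σ * E := fun j =>
    (h.lipschitz j _ _ _ _).trans (mul_le_mul_of_nonneg_left
      (add_le_add (hD j) (mul_le_mul_of_nonneg_left (hfb _ _) hς.le)) hσ)
  have hB' : B ≤ σ * E * q := by
    have h1 : |limsup (fun n => (N.aggMap n ω w).1) N.sizes - z.1| ≤ σ * E * q := by
      refine abs_limsup_sub_le (Eventually.of_forall fun n => ?_) hc.aggBig_perf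
        (hc.aggBig_one.const_mul (σ * E))
      refine (abs_aggBig_sub_le _ _ fun j => hη₀.trans (h.ηsb_mem j).1).trans ?_
      simp only [aggBig, nodeSum_eq_sum_nodes, one_mul]
      rw [mul_left_comm]
      refine mul_le_mul_of_nonneg_left ?_ (by positivity)
      rw [Finset.mul_sum]
      refine Finset.sum_le_sum fun j _ => ?_
      exact mul_le_mul_of_nonneg_right (hperf j) (hη₀.trans (h.ηsb_mem j).1)
    rwa [show limsup (fun n => (N.aggMap n ω w).1) N.sizes = w.1 from
      congrArg Prod.fst hfix] at h1
  have hD' : ∀ i : Node, |w.2 i - z.2 i.1| ≤ σ * E * r i.1 := by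
    intro i
    have h1 : |limsup (fun n => (N.aggMap n ω w).2 i) N.sizes - z.2 i.1| ≤ σ * E * r i.1 := by
      refine abs_limsup_sub_le ?_ (tendsto_of_eventually_forall_le (hc.aggSmall_perf i.1) i.2)
        ((tendsto_of_eventually_forall_le (hc.aggSmall_one i.1) i.2).const_mul (σ * E))
      filter_upwards [eventually_lt_groupSize hγ0 hγ1 i.1 i.2] with n hn
      simp only [aggMap, if_pos hn]
      refine (abs_aggSmall_sub_le _ _ fun j => h.weight_nonneg n j i).trans ?_
      simp only [aggSmall, nodeSum_eq_sum_nodes, one_mul]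
      rw [Finset.mul_sum]
      exact Finset.sum_le_sum fun j _ =>
        mul_le_mul_of_nonneg_right (hperf j) (h.weight_nonneg n j i)
    rwa [show limsup (fun n => (N.aggMap n ω w).2 i) N.sizes = w.2 i from
      congrFun (congrArg Prod.snd hfix) i] at h1
  have hσE : 0 ≤ σ * E := mul_nonneg hσ hE
  -- The bound on the mean weights enters here.
  have hD'' : D ≤ σ * E * (1 - q) := ciSup_le fun i => (hD' i).trans
    (mul_le_mul_of_nonneg_left (by linarith [hr i.1]) hσE)
  have hE0 : E ≤ σ * (1 - η₀ + ς * η₀) * E := by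
    have h1 : ς * B ≤ ς * (σ * E * q) := mul_le_mul_of_nonneg_left hB' hς.le
    -- `1 - q + ς q` decreases in `q`, as `ς ≤ 1`, and `q ≥ η₀`.
    have h2 : 0 ≤ σ * E * ((1 - ς) * (q - η₀)) :=
      mul_nonneg hσE (mul_nonneg (by linarith) (by linarith))
    calc E ≤ σ * E * (1 - q) + ς * (σ * E * q) := add_le_add hD'' h1
      _ ≤ _ := by linarith
  have hE1 : E = 0 := by nlinarith
  have hDB : D = 0 ∧ B = 0 := by
    rw [hE1] at hB' hD''
    constructor <;> linarith
  refine Prod.ext (sub_eq_zero.1 (abs_eq_zero.1 hDB.2)) (funext fun i => ?_)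
  exact sub_eq_zero.1 (abs_nonpos_iff.1 ((hD i).trans_eq hDB.1))

theorem ConvergentPath.tendsto_weightedDist (hγ1 : N.γ < 1)
    (hle : ∀ n m, N.groupSize n m ≤ n) {σ ς η₀ : ℝ} (hσ : 0 ≤ σ) (hς : 0 < ς) (hς1 : ς ≤ 1)
    (hη₀ : 0 ≤ η₀) (hη₁ : η₀ ≤ 1) (hκ : σ * (1 - η₀ + ς * η₀) < 1)
    (hfb : ∀ x u, |N.fb x - N.fb u| ≤ |x - u|) {r : Fin 2 → ℝ} {q : ℝ}
    {z : ℝ × (Fin 2 → ℝ)} {ω : Ω} (h : N.RegularPath σ ς η₀ ω) (hc : N.ConvergentPath r q z ω)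
    {x : ℕ → State} (hx : ∀ n, N.Admissible n → N.aggMap n ω (x n) = x n) :
    Tendsto (fun n => weightedDist (N.nodes n) ς (fun _ => 1 / (n : ℝ)) (x n) (constState z))
      N.sizes (𝓝 0) := by
  set κ := σ * (1 - η₀ + ς * η₀)
  have hw : ∀ n : ℕ, ∀ i ∈ N.nodes n, (0 : ℝ) ≤ (fun _ => 1 / (n : ℝ)) i :=
    fun n i _ => by positivity
  have hδ : Tendsto (fun n => weightedDist (N.nodes n) ς (fun _ => 1 / (n : ℝ))
      (N.aggMap n ω (constState z)) (constState z)) N.sizes (𝓝 0) := by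
    have h1 : Tendsto (fun n => ς * |(N.aggMap n ω (constState z)).1 - z.1|) N.sizes (𝓝 0) := by
      have h3 := ((hc.aggBig_perf.sub_const z.1).abs).const_mul ς
      simp only [sub_self, abs_zero, mul_zero] at h3
      exact h3
    have h2 : Tendsto (fun n : ℕ => ∑ i ∈ N.nodes n,
        1 / (n : ℝ) * |(N.aggMap n ω (constState z)).2 i - z.2 i.1|) N.sizes (𝓝 0) := by
      rw [Metric.tendsto_nhds]
      intro ε hε
      filter_upwards [eventually_admissible,
        eventually_all.2 fun m => hc.aggSmall_perf m (ε / 2) (by positivity)] with n hn hm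
      have hn0 : (0 : ℝ) < n := by exact_mod_cast hn.1
      rw [Real.dist_0_eq_abs, abs_of_nonneg (Finset.sum_nonneg fun i _ => by positivity),
        ← Finset.mul_sum]
      have : ∑ i ∈ N.nodes n, |(N.aggMap n ω (constState z)).2 i - z.2 i.1| ≤
          ∑ _i ∈ N.nodes n, ε / 2 := by
        refine Finset.sum_le_sum fun i hi => ?_
        have hi' := mem_nodes.1 hi
        simp only [aggMap, if_pos hi']
        exact hm i.1 i.2 (hi'.trans_le (hle n i.1))
      rw [Finset.sum_const, nsmul_eq_mul, card_nodes hγ1 hn] at this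
      refine (mul_le_mul_of_nonneg_left this (by positivity)).trans_lt ?_
      field_simp
      linarith
    simpa [weightedDist, constState] using h1.add h2
  have hlim := hδ.div_const (1 - κ)
  rw [zero_div] at hlim
  refine squeeze_zero' (Eventually.of_forall fun n =>
    weightedDist_nonneg hς.le (hw n) _ _) ?_ hlim
  filter_upwards [eventually_admissible] with n hn
  rw [le_div_iff₀ (by linarith)]
  have h1 := weightedDist_triangle (S := N.nodes n) hς.le (hw n) (x n)
    (N.aggMap n ω (constState z)) (constState z)
  have h2 := h.weightedDist_aggMap_le hγ1 hσ hς.le hς1 hη₀ hη₁ hfb hn (x n) (constState z)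
  rw [hx n hn] at h2
  change _ ≤ κ * _ at h2
  linarith

/-- Convergence in the average over the network becomes convergence at each node, as a small node
sees the others through a weighted average whose weights are nearly proportional to `1 / n`. -/
theorem ConvergentPath.tendsto_fixed (hγ0 : 0 < N.γ) (hγ1 : N.γ < 1) (hγp : ∀ s, 0 < N.γp s)
    (hle : ∀ n m, N.groupSize n m ≤ n) {σ ς η₀ y : ℝ} (hσ : 0 ≤ σ) (hς : 0 < ς) (hς1 : ς ≤ 1)
    (hη₀ : 0 ≤ η₀) (hη₁ : η₀ ≤ 1) (hκ : σ * (1 - η₀ + ς * η₀) < 1)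
    (hfb : ∀ x u, |N.fb x - N.fb u| ≤ |x - u|) (hf : ∀ m g x xb, N.f m g x xb ∈ Set.Icc 0 y)
    {r : Fin 2 → ℝ} {q : ℝ}
    {z : ℝ × (Fin 2 → ℝ)} {ω : Ω} (h : N.RegularPath σ ς η₀ ω) (hc : N.ConvergentPath r q z ω)
    {x : ℕ → State} (hx : ∀ n, N.Admissible n → N.aggMap n ω (x n) = x n) :
    Tendsto (fun n => (x n).1) N.sizes (𝓝 z.1) ∧
      ∀ m i, Tendsto (fun n => (x n).2 (m, i)) N.sizes (𝓝 (z.2 m)) := by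
  have hD := hc.tendsto_weightedDist hγ1 hle hσ hς hς1 hη₀ hη₁ hκ hfb h hx
  constructor
  · rw [tendsto_iff_dist_tendsto_zero]
    have h1 := hD.div_const ς
    rw [zero_div] at h1
    refine squeeze_zero (fun n => dist_nonneg) (fun n => ?_) h1
    rw [Real.dist_eq, le_div_iff₀' hς]
    exact mul_abs_fst_le_weightedDist (fun i _ => by positivity) (x n) (constState z)
  intro m i
  set M := ∑ s : Fin 2, 1 / N.γp s
  have hM : ∀ s, 1 / N.γp s ≤ M := fun s =>
    Finset.single_le_sum (f := fun s => 1 / N.γp s)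
      (fun s _ => (one_div_pos.2 (hγp s)).le) (Finset.mem_univ s)
  have hdiff : Tendsto (fun n => N.aggSmall n ω (N.perf ω (x n)) (m, i) -
      N.aggSmall n ω (N.perf ω (constState z)) (m, i)) N.sizes (𝓝 0) := by
    have hlim := ((hD.const_mul σ).const_mul M).add (h.tendsto_outDegreeError.const_mul y)
    simp only [mul_zero, add_zero] at hlim
    refine squeeze_zero_norm' ?_ hlim
    filter_upwards [eventually_admissible] with n hn
    have hn0 : (0 : ℝ) < n := by exact_mod_cast hn.1
    set a : Node → ℝ := fun j => |N.perf ω (x n) j - N.perf ω (constState z) j|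
    have ha : ∀ j, |a j| ≤ y := fun j => by
      have h1 : N.perf ω (x n) j ∈ Set.Icc 0 y := hf _ _ _ _
      have h2 : N.perf ω (constState z) j ∈ Set.Icc 0 y := hf _ _ _ _
      rw [abs_abs]
      exact abs_le.2 ⟨by linarith [h1.1, h2.2], by linarith [h1.2, h2.1]⟩
    have ha0 : ∀ j, 0 ≤ a j := fun j => abs_nonneg _
    have h1 := abs_le.1 (h.abs_aggSmall_sub_le_outDegreeError hη₀ n ha (m, i))
    have h2 : ∑ s : Fin 2, 1 / (n * N.γp s) * ∑ k ∈ Finset.range (N.groupSize n s),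
        a (s, k) * (1 - N.ηsb (s, k) ω) * N.edge (s, k) (m, i) ω ≤
        M * (1 / (n : ℝ) * ∑ j ∈ N.nodes n, a j) := by
      rw [← nodeSum_eq_sum_nodes, nodeSum, Finset.mul_sum, Finset.mul_sum]
      refine Finset.sum_le_sum fun s _ => ?_
      have h3 : ∑ k ∈ Finset.range (N.groupSize n s),
          a (s, k) * (1 - N.ηsb (s, k) ω) * N.edge (s, k) (m, i) ω ≤
          ∑ k ∈ Finset.range (N.groupSize n s), a (s, k) := by
        refine Finset.sum_le_sum fun k _ => ?_
        obtain ⟨e1, e2⟩ := h.edge_mem (s, k) (m, i)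
        obtain ⟨d1, d2⟩ := h.ηsb_mem (s, k)
        rw [mul_assoc]
        exact mul_le_of_le_one_right (ha0 _) (mul_le_one₀ (by linarith) e1 e2)
      have h4 : 1 / (n * N.γp s) ≤ M * (1 / (n : ℝ)) := by
        rw [mul_comm (n : ℝ), ← one_div_mul_one_div]
        exact mul_le_mul_of_nonneg_right (hM s) (by positivity)
      have hg := hγp s
      calc _ ≤ 1 / (n * N.γp s) * ∑ k ∈ Finset.range (N.groupSize n s), a (s, k) :=
            mul_le_mul_of_nonneg_left h3 (by positivity)
        _ ≤ M * (1 / (n : ℝ)) * ∑ k ∈ Finset.range (N.groupSize n s), a (s, k) :=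
            mul_le_mul_of_nonneg_right h4 (Finset.sum_nonneg fun k _ => ha0 _)
        _ = _ := mul_assoc _ _ _
    have h5 := h.mean_abs_perf_sub_le hγ1 hσ hς.le hfb hn (x n) (constState z)
    have h6 := mul_le_mul_of_nonneg_left h5
      ((one_div_pos.2 (hγp 0)).le.trans (hM 0))
    have h7 := abs_aggSmall_sub_le (N := N) (n := n) (ω := ω) (i := (m, i))
      (N.perf ω (x n)) (N.perf ω (constState z)) fun j => h.weight_nonneg n j (m, i)
    rw [Real.norm_eq_abs]
    linarith [h1.2]
  have hsum := hdiff.add (tendsto_of_eventually_forall_le (hc.aggSmall_perf m) i)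
  simp only [sub_add_cancel, zero_add] at hsum
  refine hsum.congr' ?_
  filter_upwards [eventually_admissible, eventually_lt_groupSize hγ0 hγ1 m i] with n hn hi
  conv_rhs => rw [← hx n hn]
  exact (if_pos (c := (m, i).2 < N.groupSize n (m, i).1) hi).symm

end paths
end Network
namespace Network

variable {Ω : Type*} {𝓖 : Fin 2 → Type*} [MeasurableSpace Ω] {N : Network Ω 𝓖} {P : Measure Ω}

/-! ### Almost sure properties of the sample paths -/

theorem LipschitzBound.σ_nonneg [IsProbabilityMeasure P] {σ ς : ℝ} (h3 : N.LipschitzBound P σ ς) :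
    0 ≤ σ := by
  obtain ⟨ω, hω⟩ := (h3.lipschitz_ξ (0, 0)).exists
  simpa using (abs_nonneg _).trans (hω 1 0 0 0)

variable [∀ m, MeasurableSpace (𝓖 m)]

theorem ae_regularPath {σ ς η₀ : ℝ} (hN : N.IsModel P)
    (h2 : N.GraphGrowth P) (h3 : N.LipschitzBound P σ ς)
    (hη : ∀ j, ∀ᵐ ω ∂P, η₀ ≤ N.ηsb j ω) : ∀ᵐ ω ∂P, N.RegularPath σ ς η₀ ω := by
  filter_upwards [h2.growth, ae_all_iff.2 h3.lipschitz_ξ, ae_all_iff.2 hη,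
    ae_all_iff.2 hN.ηsb_mem] with ω a1 a2 a3 a4
  refine ⟨fun j i => ?_, fun j => ⟨a3 j, (a4 j).2⟩, a2, a1⟩
  rcases hN.edge_indicator j i ω with h | h <;> simp [h]

/-- The law of large numbers turns the equations of the three-dimensional system into the limits of
the aggregates at `z`. -/
theorem ae_convergentPath [IsProbabilityMeasure P] [∀ m, TopologicalSpace (𝓖 m)]
    [∀ m, BorelSpace (𝓖 m)] {y σ ς η₀ : ℝ} (hN : N.IsModel P)
    (h1 : N.BoundedContinuous y) (h2 : N.GraphGrowth P) (h3 : N.LipschitzBound P σ ς)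
    (hη₀ : 0 ≤ η₀) (hη : ∀ j, ∀ᵐ ω ∂P, η₀ ≤ N.ηsb j ω) {z : ℝ × (Fin 2 → ℝ)}
    (hz : N.threeDimMap P z = z) :
    ∀ᵐ ω ∂P, N.ConvergentPath (N.received P) (∑ s : Fin 2, N.frac s * N.psb P s) z ω := by
  have hy : 0 ≤ y := (h1.fb_mem 0).1.trans (h1.fb_mem 0).2
  have hF := h1.measurable_f z.2 (N.fb z.1)
  have hF1 : ∀ s, Measurable (Function.uncurry fun (_ : 𝓖 s) (_ : ℝ) => (1 : ℝ)) :=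
    fun s => measurable_const
  -- The law of large numbers is stated for a positive bound, and `y` may be `0`.
  have hb : ∀ s g e, N.f s g (z.2 s) (e * N.fb z.1) ∈ Set.Icc 0 (y + 1) := fun s g e =>
    ⟨(h1.f_mem _ _ _ _).1, by linarith [(h1.f_mem s g (z.2 s) (e * N.fb z.1)).2]⟩
  have hb1 : ∀ (s : Fin 2) (_ : 𝓖 s) (_ : ℝ), (1 : ℝ) ∈ Set.Icc (0 : ℝ) 1 := by simp
  filter_upwards [ae_regularPath hN h2 h3 hη,
    hN.ae_sum_nodeFun_mul_edge hF (by positivity : 0 < y + 1) hb,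
    hN.ae_sum_nodeFun_mul_edge hF1 one_pos hb1,
    hN.ae_sum_nodeFun_mul_ηsb hF (by positivity : 0 < y + 1) hb,
    hN.ae_sum_nodeFun_mul_ηsb hF1 one_pos hb1] with ω hreg l1 l2 l3 l4
  constructor
  · intro m ε hε
    have := hreg.eventually_abs_aggSmall_sub_le hη₀ hN.γ_lt_one h2.γp_pos
      (a := N.perf ω (constState z)) (C := y)
      (e := fun s => N.meanξ P s (z.2 s) (N.fb z.1) * (1 - N.psb P s)) (m := m)
      (fun j => (abs_of_nonneg (h1.f_mem _ _ _ _).1).trans_le (h1.f_mem _ _ _ _).2)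
      (fun s => l1 s m) hε
    have e : ∑ s : Fin 2, N.frac s * N.edgeProb s m / N.γp s *
        (N.meanξ P s (z.2 s) (N.fb z.1) * (1 - N.psb P s)) = z.2 m := by
      conv_rhs => rw [← hz]
      simp only [threeDimMap]
      exact Finset.sum_congr rfl fun s _ => by ring
    rwa [e] at this
  · intro m ε hε
    have := hreg.eventually_abs_aggSmall_sub_le hη₀ hN.γ_lt_one h2.γp_pos
      (a := fun _ => 1) (C := 1) (e := fun s => 1 - N.psb P s) (m := m) (by simp)
      (fun s => by simpa [nodeFun] using l2 s m) hε
    have e : ∑ s : Fin 2, N.frac s * N.edgeProb s m / N.γp s * (1 - N.psb P s) =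
        N.received P m := Finset.sum_congr rfl fun s _ => by ring
    rwa [e] at this
  · have := tendsto_aggBig hN.γ_lt_one (a := N.perf ω (constState z))
      (e := fun s => N.meanξ P s (z.2 s) (N.fb z.1) * N.psb P s) fun s => l3 s
    have e : ∑ s : Fin 2, N.frac s * (N.meanξ P s (z.2 s) (N.fb z.1) * N.psb P s) = z.1 := by
      conv_rhs => rw [← hz]
      simp only [threeDimMap]
      exact Finset.sum_congr rfl fun s _ => by ring
    rwa [e] at this
  · exact tendsto_aggBig hN.γ_lt_one (a := fun _ => 1) (e := fun s => N.psb P s)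
      fun s => by simpa [nodeFun] using l4 s

end Network
end FPNet

open FPNet FPNet.Network in
theorem corollary1 {Ω : Type*} [MeasurableSpace Ω] (P : Measure Ω) [IsProbabilityMeasure P]
    {𝓖 : Fin 2 → Type*} [∀ m, TopologicalSpace (𝓖 m)] [∀ m, MeasurableSpace (𝓖 m)]
    [∀ m, BorelSpace (𝓖 m)]
    (N : FPNet.Network Ω 𝓖) (y σ ς η₀ : ℝ)
    (hN : N.IsModel P) (h1 : N.BoundedContinuous y) (h2 : N.GraphGrowth P) (h3 : N.LipschitzBound P σ ς) (h4 : N.MeanWeightBound P)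
    (hη₀ : 0 ≤ η₀) (hη : ∀ j, ∀ᵐ ω ∂P, η₀ ≤ N.ηsb j ω)
    (hσ : σ * (1 - η₀ + ς * η₀) < 1) :
    ∃ z : ℝ × (Fin 2 → ℝ),
      -- `z` is the unique fixed point of the three-dimensional system, and it lies in `[0, y]³`
      N.threeDimMap P z = z ∧ (∀ w, N.threeDimMap P w = w → w = z) ∧
      z.1 ∈ Set.Icc 0 y ∧ (∀ m, z.2 m ∈ Set.Icc 0 y) ∧
      ∀ᵐ ω ∂P,
        -- the constant sequence given by `z` is the unique fixed point of the limit system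
        (N.limitMap ω (FPNet.constState z) = FPNet.constState z ∧
          ∀ w : FPNet.State, w.1 ∈ Set.Icc 0 y → (∀ i, w.2 i ∈ Set.Icc 0 y) →
            N.limitMap ω w = w → w = FPNet.constState z) ∧
        -- the systems of size `n` have unique fixed points
        (∀ n, N.Admissible n →
          (∃! X : FPNet.State, N.perfMap n ω X = X) ∧
          (∃! x : FPNet.State, N.aggMap n ω x = x)) ∧
        -- the fixed points of the aggregate systems converge along the full sequence
        (∀ x : ℕ → FPNet.State, (∀ n, N.Admissible n → N.aggMap n ω (x n) = x n) →
          Tendsto (fun n => (x n).1) N.sizes (𝓝 z.1) ∧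
          ∀ m i, Tendsto (fun n => (x n).2 (m, i)) N.sizes (𝓝 (z.2 m))) ∧
        -- so do the aggregates of the original systems, and their fixed points
        (∀ X : ℕ → FPNet.State, (∀ n, N.Admissible n → N.perfMap n ω (X n) = X n) →
          (Tendsto (fun n => N.aggBig n ω (X n).2) N.sizes (𝓝 z.1) ∧
            ∀ m i, Tendsto (fun n => N.aggSmall n ω (X n).2 (m, i)) N.sizes (𝓝 (z.2 m))) ∧
          Tendsto (fun n => (X n).1) N.sizes (𝓝 (N.fb z.1)) ∧
          ∀ m i, Tendsto (fun n => (X n).2 (m, i)) N.sizes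
            (𝓝 (N.f m (N.G m i ω) (z.2 m) (N.ηbs (m, i) ω * N.fb z.1)))) := by
  have hσ0 := h3.σ_nonneg
  have hy : 0 ≤ y := (h1.fb_mem 0).1.trans (h1.fb_mem 0).2
  have hη₁ : η₀ ≤ 1 := (hN.psb_mem hη 0).1.trans (hN.psb_mem hη 0).2
  have hγ0 := hN.γ_pos
  have hγ1 := hN.γ_lt_one
  obtain ⟨z, hz, hzu⟩ := existsUnique_fixed_of_weightedDist_le (S := Finset.univ) h3.ς_pos
    (fun s _ => hN.frac_pos s) hσ (T := N.threeDimMap P)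
    (fun _ i hi => absurd (Finset.mem_univ i) hi)
    (weightedDist_threeDimMap_le hN h1 h2.γp_pos h3 hσ0 hη₀ hη)
  have hz2 := snd_mem_of_threeDimMap_eq hy hN h1 h2.γp_pos h4 hη₀ hη hz
  refine ⟨z, hz, hzu, fst_mem_of_threeDimMap_eq hy hN h1 hη₀ hη hz, hz2, ?_⟩
  filter_upwards [ae_regularPath hN h2 h3 hη, ae_convergentPath hN h1 h2 h3 hη₀ hη hz]
    with ω hreg hconv
  have huniq : ∀ n, N.Admissible n → ∃! x, N.aggMap n ω x = x := fun n hn =>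
    hreg.existsUnique_aggMap hγ1 hσ0 h3.ς_pos h3.ς_le_one hη₀ hη₁ hσ h3.lipschitz_fb hn
  have hlim : ∀ x : ℕ → State, (∀ n, N.Admissible n → N.aggMap n ω (x n) = x n) →
      Tendsto (fun n => (x n).1) N.sizes (𝓝 z.1) ∧
        ∀ m i, Tendsto (fun n => (x n).2 (m, i)) N.sizes (𝓝 (z.2 m)) := fun x hx =>
    hconv.tendsto_fixed hγ0 hγ1 h2.γp_pos hN.groupSize_le hσ0 h3.ς_pos h3.ς_le_one hη₀ hη₁ hσ
      h3.lipschitz_fb h1.f_mem hreg hx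
  refine ⟨⟨hconv.limitMap_constState hγ0 hγ1 hN.exists_admissible, fun w _ hw hfix =>
    hconv.eq_constState_of_limitMap_eq hγ0 hγ1 hN.exists_admissible hσ0 h3.ς_pos h3.ς_le_one hη₀
      hσ h3.lipschitz_fb (sum_frac_mul_psb_mem hN hη).1
      (fun m => (add_le_add (received_le m) le_rfl).trans h4) hz2 hreg hw hfix⟩,
    fun n hn => ⟨existsUnique_perfMap (huniq n hn), huniq n hn⟩, hlim, fun X hX => ?_⟩
  -- The aggregates of solutions of the network equations are fixed points of the aggregate maps.
  obtain ⟨t1, t2⟩ := hlim (fun n => N.aggregate n ω (X n)) fun n hn => aggMap_aggregate (hX n hn)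
  have t1' : Tendsto (fun n => N.aggBig n ω (X n).2) N.sizes (𝓝 z.1) := t1
  have t2' : ∀ m i, Tendsto (fun n => N.aggSmall n ω (X n).2 (m, i)) N.sizes (𝓝 (z.2 m)) := by
    intro m i
    refine (t2 m i).congr' ?_
    filter_upwards [eventually_lt_groupSize hγ0 hγ1 m i] with n hn
    exact if_pos hn
  have t3 : Tendsto (fun n => (X n).1) N.sizes (𝓝 (N.fb z.1)) := by
    refine ((h1.continuous_fb.tendsto _).comp t1').congr' ?_
    filter_upwards [eventually_admissible] with n hn
    exact congrArg Prod.fst (hX n hn)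
  refine ⟨⟨t1', t2'⟩, t3, fun m i => ?_⟩
  have t4 := ((h1.continuous_f m).tendsto (N.G m i ω, z.2 m, N.ηbs (m, i) ω * N.fb z.1)).comp
    (tendsto_const_nhds.prodMk_nhds ((t2' m i).prodMk_nhds (t3.const_mul (N.ηbs (m, i) ω))))
  refine t4.congr' ?_
  filter_upwards [eventually_admissible, eventually_lt_groupSize hγ0 hγ1 m i] with n hn hi
  conv_rhs => rw [← hX n hn]
  exact (if_pos (c := (m, i).2 < N.groupSize n (m, i).1) hi).symm
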